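/- Let $\mathbb{D}=\{z\in\mathbb{C}:|z|<1\}$. Let $\mathcal{A}$ be the class of functions $f$ analytic in $\mathbb{D}$ with $f(0)=0$, $f'(0)=1$. For functions $F,G$ on $\mathbb{D}$ write $F\prec G$ if $F=G\circ w$ for some analytic $w:\mathbb{D}\to\mathbb{D}$ with $w(0)=0$. Let $\mathcal{S}^*_{car}$ be the class of those $f\in\mathcal{A}$ that are univalent in $\mathbb{D}$ and satisfy $$\frac{zf'(z)}{f(z)}\prec 1+z+\frac{z^2}{2}.$$ For $\chi\in\mathcal{A}$ with no zeros in $\mathbb{D}\setminus\{0\}$ put $$\mathcal{F}_1^\chi=\Big\{f\in\mathcal{A}:\ \operatorname{Re}\frac{f(z)}{g(z)}>0\ \text{ for some } g\in\mathcal{A}\text{ with } \operatorname{Re}\frac{g(z)}{\chi(z)}>0\Big\},$$ $$\mathcal{F}_2^\chi=\Big\{f\in\mathcal{A}:\ \Big|\frac{f(z)}{g(z)}-1\Big|<1\ \text{ for some } g\in\mathcal{A}\text{ with } \operatorname{Re}\frac{g(z)}{\chi(z)}>0\Big\},$$ $$\mathcal{F}_3^\chi=\Big\{f\in\mathcal{A}:\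 \operatorname{Re}\frac{f(z)}{\chi(z)}>0\Big\},$$ where the inequalities are to hold throughout $\mathbb{D}$; at $z=0$ the quotients $zf'/f$, $f/g$, $g/\chi$, $f/\chi$ take their limit value $1$. For a class $\mathcal{F}\subset\mathcal{A}$, the $\mathcal{S}^*_{car}$-radius of $\mathcal{F}$ is the largest $\rho\in(0,1]$ such that $z\mapsto f(rz)/r$ belongs to $\mathcal{S}^*_{car}$ for all $f\in\mathcal{F}$ and all $0<r\le\rho$. It is called sharp if there is one $f_0\in\mathcal{F}$ such that $z\mapsto f_0(rz)/r$ is not in $\mathcal{S}^*_{car}$ for any $r\in(\rho,1]$. **Theorem.** The $\mathcal{S}^*_{car}$-radii $R_i^\chi$ of the classes $\mathcal{F}_i^\chi$ ($i=1,2,3$) exist, are sharp, and are given by the following table. | | $\chi$ | $R_1^\chi$ | $R_2^\chi$ | $R_3^\chi$ | |---|---|---|---|---| | (a) | $z$ | $\dfrac{1}{4+\sqrt{17}}$ | $\dfrac{1}{3+2\sqrt3}$ | $\dfrac{1}{2+\sqrt5}$ | | (b) | $\dfrac{z}{1+z}$ | $5-2\sqrt6$ | $\sqrt{17}-4$ |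 $3-2\sqrt2$ | | (c) | $\dfrac{z}{1-z^2}$ | $r_1\approx0.11667$ | $r_2\approx0.14326$ | $r_3\approx0.20213$ | | (d) | $\dfrac{z}{(1-z)^2}$ | $\dfrac{6-\sqrt{33}}{3}$ | $5-2\sqrt6$ | $\dfrac{4-\sqrt{13}}{3}$ | | (e) | $z+\dfrac{z^2}{2}$ | $s_1\approx0.10924$ | $s_2\approx0.13414$ | $s_3\approx0.19028$ | Here $r_1,r_2,r_3$ are the smallest roots in $(0,1)$ of $3r^4-8r^3-4r^2-8r+1=0$, $r^4-6r^3-6r^2-6r+1=0$ and $3r^4-4r^3-4r^2-4r+1=0$ respectively, and $s_1,s_2,s_3$ are the smallest roots in $(0,1)$ of $3r^3+6r^2-19r+2=0$, $5r^3-15r+2=0$ and $3r^3+2r^2-11r+2=0$ respectively. The decimal values are correct with an error less than $10^{-5}$. -/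

import Mathlib

noncomputable section

namespace CardioidRadius

/-- The open unit disk of the complex plane. -/
def unitDisk : Set ℂ := Metric.ball (0 : ℂ) 1

/-- The class of functions analytic in the unit disk with `f 0 = 0` and `f' 0 = 1`. Only the
values of `f` on the unit disk matter. -/
def ClassA : Set (ℂ → ℂ) :=
  {f | DifferentiableOn ℂ f unitDisk ∧ f 0 = 0 ∧ deriv f 0 = 1}

/-- The normalized analytic functions that are univalent in the unit disk. -/
def ClassS : Set (ℂ → ℂ) :=
  {f | f ∈ ClassA ∧ Set.InjOn f unitDisk}

/-- Subordination `F ≺ G` in the unit disk: `F = G ∘ w` for an analytic self-map `w` of the unit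
disk that fixes the origin. -/
def Subordinate (F G : ℂ → ℂ) : Prop :=
  ∃ w : ℂ → ℂ, DifferentiableOn ℂ w unitDisk ∧ Set.MapsTo w unitDisk unitDisk ∧ w 0 = 0 ∧
    ∀ z ∈ unitDisk, F z = G (w z)

/-- The function `z f'(z) / f(z)`, with its removable singularity at the origin filled in: for a
normalized analytic `f` its value there is `1`. -/
def logDerivQuotient (f : ℂ → ℂ) (z : ℂ) : ℂ :=
  if z = 0 then 1 else z * deriv f z / f z

/-- The class of all univalent normalized `f` with `z f'(z) / f(z) ≺ φ`. For univalent `f` with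
`f 0 = 0` the quotient is never a division by zero in the punctured disk. -/
def StarlikeClass (φ : ℂ → ℂ) : Set (ℂ → ℂ) :=
  {f | f ∈ ClassS ∧ Subordinate (logDerivQuotient f) φ}

/-- The function `1 + z + z² / 2`, which maps the unit disk onto the inside of a cardioid. -/
def phiCar (z : ℂ) : ℂ := 1 + z + z ^ 2 / 2

/-- The class of starlike functions associated with the cardioid. -/
def StarlikeCar : Set (ℂ → ℂ) := StarlikeClass phiCar

/-- `Re (f / g) > 0` in the unit disk. The origin is left out: for normalized `f` and `g` the
quotient has a removable singularity there, with value `1`. At a point where `g z = 0` the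
condition fails, since Lean's quotient is then `0`. -/
def RatioPos (f g : ℂ → ℂ) : Prop :=
  ∀ z ∈ unitDisk, z ≠ 0 → 0 < (f z / g z).re

/-- `|f / g - 1| < 1` in the unit disk. The origin is left out: for normalized `f` and `g` the
quotient has a removable singularity there, with value `1`. At a point where `g z = 0` the
condition fails, since Lean's quotient is then `0`. -/
def RatioNearOne (f g : ℂ → ℂ) : Prop :=
  ∀ z ∈ unitDisk, z ≠ 0 → ‖f z / g z - 1‖ < 1

/-- The first ratio class of `χ`. -/
def ratioClass₁ (χ : ℂ → ℂ) : Set (ℂ → ℂ) :=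
  {f | f ∈ ClassA ∧ ∃ g ∈ ClassA, RatioPos f g ∧ RatioPos g χ}

/-- The second ratio class of `χ`. -/
def ratioClass₂ (χ : ℂ → ℂ) : Set (ℂ → ℂ) :=
  {f | f ∈ ClassA ∧ ∃ g ∈ ClassA, RatioNearOne f g ∧ RatioPos g χ}

/-- The third ratio class of `χ`. -/
def ratioClass₃ (χ : ℂ → ℂ) : Set (ℂ → ℂ) :=
  {f | f ∈ ClassA ∧ RatioPos f χ}

/-- The dilation `z ↦ f (r z) / r`, which carries `f` on the disk of radius `r` to the unit
disk. -/
def dilation (r : ℝ) (f : ℂ → ℂ) : ℂ → ℂ := fun z => f ((r : ℂ) * z) / (r : ℂ)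

/-- `R` is the radius of the class `M` for the class `F`: the largest `ρ ∈ (0, 1]` such that
`z ↦ f (r z) / r` belongs to `M` for every `f ∈ F` and every `0 < r ≤ ρ`. -/
def IsRadius (M F : Set (ℂ → ℂ)) (R : ℝ) : Prop :=
  IsGreatest {ρ : ℝ | 0 < ρ ∧ ρ ≤ 1 ∧ ∀ f ∈ F, ∀ r : ℝ, 0 < r → r ≤ ρ → dilation r f ∈ M} R

/-- `R` is the radius of the class `M` for the class `F`, and it is sharp: one function of `F`
leaves `M` at every larger radius. -/
def IsSharpRadius (M F : Set (ℂ → ℂ)) (R : ℝ) : Prop :=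
  IsRadius M F R ∧ ∃ f₀ ∈ F, ∀ r : ℝ, R < r → r ≤ 1 → dilation r f₀ ∉ M

/-- `R₁, R₂, R₃` are the sharp cardioid-starlikeness radii of the three ratio classes of `χ`. -/
def HasCarRadii (χ : ℂ → ℂ) (R₁ R₂ R₃ : ℝ) : Prop :=
  IsSharpRadius StarlikeCar (ratioClass₁ χ) R₁ ∧
  IsSharpRadius StarlikeCar (ratioClass₂ χ) R₂ ∧
  IsSharpRadius StarlikeCar (ratioClass₃ χ) R₃

/-- `r` is the smallest zero of `p` in the interval `(0, 1)`. -/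
def IsLeastRoot (p : ℝ → ℝ) (r : ℝ) : Prop :=
  IsLeast {x : ℝ | 0 < x ∧ x < 1 ∧ p x = 0} r

end CardioidRadius

end

namespace CardioidRadius

open Complex Metric Set ComplexConjugate

/-! Dividing out gives `f = p * χ` or `f = p * q * χ`, so `z f'/f` differs from `z χ'/χ` by terms `z
p'/p`. On `|z| = s` Schwarz–Pick bounds such a term by `2s/(1-s²)` if `Re p > 0`, and by
`(s+s²)/(1-s²)` if `|p - 1| < 1` and `p 0 = 1`. Let `ε s` be the total bound. For each `χ` the
values of `z χ'/χ` on `|z| = s` lie in a closed disk with real centre `a ≤ 3/2` and leftmost point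
`m s`, so `z f'/f` lies in the concentric disk with leftmost point `m s - ε s`.

Since `phiCar z = (1 + (1+z)²)/2`, the cardioid has its cusp at `1/2`, and every disk `|w - a| < a -
1/2` with `a ≤ 3/2` lies inside it (`norm_sub_one_lt_of_sq`). Hence `m - ε > 1/2` gives the
subordination, by taking a square root (`subordinate_phiCar`); univalence follows because then `Re
(z f'/f) > 1/2`.

For sharpness, rotated extremal factors attain every bound at once at the point where `m` is
attained. So `z f'/f` equals `1/2` on the critical circle. The open disk omits the cusp, hence this
one `f` fails at every larger radius. The radius is thus the first solution of `m - ε = 1/2`, a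
polynomial equation in `s`; all solutions lie below `1/4`, where the polynomials are strictly
decreasing. -/

/-! ### Schwarz–Pick estimates for logarithmic derivatives -/

theorem mem_unitDisk {z : ℂ} : z ∈ unitDisk ↔ ‖z‖ < 1 := by
  simp [unitDisk]

theorem isOpen_unitDisk : IsOpen unitDisk := isOpen_ball

theorem one_add_ne_zero_of_norm_lt {z : ℂ} (hz : ‖z‖ < 1) : 1 + z ≠ 0 := by
  intro h
  have : z = -1 := by linear_combination h
  simp [this] at hz

theorem one_sub_ne_zero_of_norm_lt {z : ℂ} (hz : ‖z‖ < 1) : 1 - z ≠ 0 := by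
  intro h
  have : z = 1 := by linear_combination -h
  simp [this] at hz

theorem norm_conj_mul_lt_one {a z : ℂ} (ha : ‖a‖ < 1) (hz : ‖z‖ < 1) : ‖conj a * z‖ < 1 := by
  rw [norm_mul, Complex.norm_conj]
  nlinarith [norm_nonneg a, norm_nonneg z]

/-- A disk automorphism maps the unit disk to itself. -/
theorem norm_mobius_lt_one {a z : ℂ} (ha : ‖a‖ < 1) (hz : ‖z‖ < 1) :
    ‖(z + a) / (1 + conj a * z)‖ < 1 := by
  have h0 := one_add_ne_zero_of_norm_lt (norm_conj_mul_lt_one ha hz)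
  rw [norm_div, div_lt_one (norm_pos_iff.2 h0)]
  refine lt_of_pow_lt_pow_left₀ 2 (norm_nonneg _) ?_
  have ha2 : ‖a‖ ^ 2 < 1 := by nlinarith [norm_nonneg a]
  have hz2 : ‖z‖ ^ 2 < 1 := by nlinarith [norm_nonneg z]
  rw [Complex.sq_norm, normSq_apply] at *
  simp only [Complex.sq_norm, normSq_apply, add_re, add_im, mul_re, mul_im, conj_re, conj_im,
    one_re, one_im] at *
  nlinarith [mul_pos (sub_pos.2 ha2) (sub_pos.2 hz2)]

/-- The Schwarz–Pick lemma for maps of the unit disk into the right half-plane. -/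
theorem norm_deriv_le_of_re_pos {p : ℂ → ℂ} (hp : DifferentiableOn ℂ p unitDisk)
    (hpos : ∀ z ∈ unitDisk, 0 < (p z).re) {a : ℂ} (ha : a ∈ unitDisk) :
    ‖deriv p a‖ * (1 - ‖a‖ ^ 2) ≤ 2 * (p a).re := by
  have ha1 := mem_unitDisk.1 ha
  have ha2 : ‖a‖ ^ 2 < 1 := by nlinarith [norm_nonneg a]
  set c := p a with hc
  have hcpos : 0 < c.re := hpos a ha
  set ψ : ℂ → ℂ := fun z => (z + a) / (1 + conj a * z) with hψ
  have hden : ∀ z ∈ unitDisk, 1 + conj a * z ≠ 0 := fun z hz =>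
    one_add_ne_zero_of_norm_lt (norm_conj_mul_lt_one ha1 (mem_unitDisk.1 hz))
  have hψm : MapsTo ψ unitDisk unitDisk := fun z hz =>
    mem_unitDisk.2 (norm_mobius_lt_one ha1 (mem_unitDisk.1 hz))
  have hψd : DifferentiableOn ℂ ψ unitDisk :=
    DifferentiableOn.div (by fun_prop) (by fun_prop) hden
  have h0 : (0 : ℂ) ∈ unitDisk := mem_unitDisk.2 (by simp)
  have hψ0 : ψ 0 = a := by simp [hψ]
  have hψ' : HasDerivAt ψ (1 - (‖a‖ : ℂ) ^ 2) 0 := by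
    have h1 : HasDerivAt (fun z : ℂ => z + a) 1 0 := (hasDerivAt_id _).add_const a
    have h2 : HasDerivAt (fun z : ℂ => 1 + conj a * z) (conj a) 0 := by
      simpa using ((hasDerivAt_id (0 : ℂ)).const_mul (conj a)).const_add 1
    refine (h1.div h2 (hden 0 h0)).congr_deriv ?_
    simp [Complex.mul_conj']
  have hq : ∀ z ∈ unitDisk, p z + conj c ≠ 0 := by
    intro z hz h
    have := congrArg Complex.re h
    simp at this
    linarith [hpos z hz]
  -- Moving `a` to the origin by `ψ`, and `c` to the origin by a Cayley transform of the half-plane,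
  -- reduces the claim to `|h'(0)| ≤ 1`.
  set h : ℂ → ℂ := fun z => (p (ψ z) - c) / (p (ψ z) + conj c) with hh
  have hpψ : DifferentiableOn ℂ (fun z => p (ψ z)) unitDisk := hp.comp hψd hψm
  have hhd : DifferentiableOn ℂ h unitDisk :=
    (hpψ.sub_const c).div (hpψ.add_const _) fun z hz => hq _ (hψm hz)
  have hh0 : h 0 = 0 := by simp [hh, hψ0, hc]
  have hhm : MapsTo h unitDisk (closedBall (h 0) 1) := by
    intro z hz
    have hz' := hψm hz
    rw [hh0, mem_closedBall_zero_iff, norm_div, div_le_one (norm_pos_iff.2 (hq _ hz'))]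
    refine le_of_sq_le_sq ?_ (norm_nonneg _)
    have := mul_pos (hpos _ hz') hcpos
    simp only [Complex.sq_norm, normSq_apply, sub_re, sub_im, add_re, add_im, conj_re, conj_im]
    nlinarith
  have hpa : HasDerivAt p (deriv p a) (ψ 0) := by
    rw [hψ0]
    exact (hp.differentiableAt (isOpen_unitDisk.mem_nhds ha)).hasDerivAt
  have hcomp := hpa.comp 0 hψ'
  have hcc : c + conj c = ((2 * c.re : ℝ) : ℂ) := by rw [Complex.add_conj]
  have hh' : HasDerivAt h (deriv p a * (1 - (‖a‖ : ℂ) ^ 2) / ((2 * c.re : ℝ) : ℂ)) 0 := by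
    refine ((hcomp.sub_const c).div (hcomp.add_const (conj c)) (hq _ (hψm h0))).congr_deriv ?_
    have : ((2 * c.re : ℝ) : ℂ) ≠ 0 := by
      exact_mod_cast (by positivity : (2 * c.re) ≠ 0)
    simp only [Function.comp_apply, hψ0, ← hc, hcc]
    field_simp
    simp
  have hfin := norm_deriv_le_one_of_mapsTo_ball hhd hhm one_pos
  rw [hh'.deriv, norm_div, norm_mul, Complex.norm_real, Real.norm_of_nonneg (by positivity),
    div_le_one (by positivity)] at hfin
  have : ‖(1 - (‖a‖ : ℂ) ^ 2)‖ = 1 - ‖a‖ ^ 2 := by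
    have : (1 - (‖a‖ : ℂ) ^ 2) = ((1 - ‖a‖ ^ 2 : ℝ) : ℂ) := by push_cast; rfl
    rw [this, Complex.norm_real, Real.norm_of_nonneg (by linarith)]
  rwa [this] at hfin

/-- The Schwarz–Pick lemma for the derivative of a self-map of the unit disk. -/
theorem norm_deriv_le_of_mapsTo_unitDisk {w : ℂ → ℂ} (hw : DifferentiableOn ℂ w unitDisk)
    (hm : MapsTo w unitDisk unitDisk) {a : ℂ} (ha : a ∈ unitDisk) :
    ‖deriv w a‖ * (1 - ‖a‖ ^ 2) ≤ 1 - ‖w a‖ ^ 2 := by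
  have hden : ∀ z ∈ unitDisk, 1 - w z ≠ 0 := fun z hz =>
    one_sub_ne_zero_of_norm_lt (mem_unitDisk.1 (hm hz))
  have hre : ∀ z ∈ unitDisk, ((1 + w z) / (1 - w z)).re = (1 - ‖w z‖ ^ 2) / ‖1 - w z‖ ^ 2 := by
    intro z hz
    simp only [Complex.div_re, Complex.sq_norm, normSq_apply, add_re, add_im, sub_re, sub_im,
      one_re, one_im]
    ring
  -- The Cayley transform of `w` has positive real part, so the half-plane version applies to it.
  have key := norm_deriv_le_of_re_pos (p := fun z => (1 + w z) / (1 - w z))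
    ((hw.const_add 1).div (hw.const_sub 1) hden) (fun z hz => by
      rw [hre z hz]
      have h1 := mem_unitDisk.1 (hm hz)
      have h2 := norm_pos_iff.2 (hden z hz)
      have : 0 < 1 - ‖w z‖ ^ 2 := by nlinarith [norm_nonneg (w z)]
      positivity) ha
  have hwa := (hw.differentiableAt (isOpen_unitDisk.mem_nhds ha)).hasDerivAt
  have hd : HasDerivAt (fun z => (1 + w z) / (1 - w z)) (2 * deriv w a / (1 - w a) ^ 2) a := by
    refine ((hwa.const_add 1).div (hwa.const_sub 1) (hden a ha)).congr_deriv ?_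
    congr 1
    ring
  have h2 := norm_pos_iff.2 (hden a ha)
  have h3 : 0 < ‖1 - w a‖ ^ 2 := by positivity
  rw [hd.deriv, hre a ha, norm_div, norm_mul, norm_pow, Complex.norm_ofNat, div_mul_eq_mul_div,
    ← mul_div_assoc, div_le_div_iff_of_pos_right h3] at key
  linarith

/-- The logarithmic derivative of a function with positive real part. -/
theorem norm_mul_logDeriv_le_of_re_pos {p : ℂ → ℂ} (hp : DifferentiableOn ℂ p unitDisk)
    (hpos : ∀ z ∈ unitDisk, 0 < (p z).re) {z : ℂ} (hz : z ∈ unitDisk) :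
    ‖z * logDeriv p z‖ ≤ 2 * ‖z‖ / (1 - ‖z‖ ^ 2) := by
  have hz1 := mem_unitDisk.1 hz
  have hz2 : 0 < 1 - ‖z‖ ^ 2 := by nlinarith [norm_nonneg z]
  have h1 := norm_deriv_le_of_re_pos hp hpos hz
  have h2 := (hpos z hz).trans_le (Complex.re_le_norm _)
  rw [logDeriv_apply, norm_mul, norm_div, ← mul_div_assoc, div_le_div_iff₀ h2 hz2]
  nlinarith [norm_nonneg z, Complex.re_le_norm (p z),
    mul_le_mul_of_nonneg_left (h1.trans (mul_le_mul_of_nonneg_left (Complex.re_le_norm (p z))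
      zero_le_two)) (norm_nonneg z)]

/-- The logarithmic derivative of a normalized function with values in the disk of radius one
around one. -/
theorem norm_mul_logDeriv_le_of_norm_sub_one_lt {p : ℂ → ℂ} (hp : DifferentiableOn ℂ p unitDisk)
    (h1 : ∀ z ∈ unitDisk, ‖p z - 1‖ < 1) (hp0 : p 0 = 1) {z : ℂ} (hz : z ∈ unitDisk) :
    ‖z * logDeriv p z‖ ≤ (‖z‖ + ‖z‖ ^ 2) / (1 - ‖z‖ ^ 2) := by
  have hz1 := mem_unitDisk.1 hz
  have hz2 : 0 < 1 - ‖z‖ ^ 2 := by nlinarith [norm_nonneg z]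
  have hm : MapsTo (fun z => p z - 1) unitDisk unitDisk := fun z hz => mem_unitDisk.2 (h1 z hz)
  have hd := norm_deriv_le_of_mapsTo_unitDisk (hp.sub_const 1) hm hz
  have hs : ‖p z - 1‖ ≤ ‖z‖ := Complex.norm_le_norm_of_mapsTo_ball (R := 1) (hp.sub_const 1)
    (fun z hz => ball_subset_closedBall (hm hz)) (by simp [hp0]) hz1
  rw [deriv_sub_const] at hd
  set u := ‖p z - 1‖
  have hpu : 1 - u ≤ ‖p z‖ := by
    have := norm_sub_norm_le (1 : ℂ) (1 - p z)
    rw [norm_one, norm_sub_rev 1 (p z), sub_sub_cancel] at this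
    exact this
  have hu : u < 1 := h1 z hz
  have hu0 : 0 ≤ u := norm_nonneg _
  have hpz : 0 < ‖p z‖ := by linarith
  rw [logDeriv_apply, norm_mul, norm_div, ← mul_div_assoc, div_le_div_iff₀ hpz hz2]
  calc ‖z‖ * ‖deriv p z‖ * (1 - ‖z‖ ^ 2) = ‖z‖ * (‖deriv p z‖ * (1 - ‖z‖ ^ 2)) := by ring
    _ ≤ ‖z‖ * ((1 + ‖z‖) * (1 - u)) := by
        -- Schwarz–Pick gives `1 - u² = (1 + u)(1 - u)`, and the Schwarz lemma gives `u ≤ |z|`.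
        refine mul_le_mul_of_nonneg_left (hd.trans ?_) (norm_nonneg z)
        nlinarith
    _ ≤ ‖z‖ * ((1 + ‖z‖) * ‖p z‖) := by gcongr
    _ = (‖z‖ + ‖z‖ ^ 2) * ‖p z‖ := by ring

/-! ### Univalence of starlike functions -/

/-- The Noshiro–Warschawski theorem. -/
theorem injOn_of_re_deriv_pos {U : Set ℂ} (hU : Convex ℝ U) {F F' : ℂ → ℂ}
    (hF : ∀ z ∈ U, HasDerivAt F (F' z) z) (hpos : ∀ z ∈ U, 0 < (F' z).re) : InjOn F U := by
  intro a ha b hb hab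
  by_contra hne
  have hba : b - a ≠ 0 := sub_ne_zero.2 (Ne.symm hne)
  have hmem : ∀ t ∈ Icc (0 : ℝ) 1, a + (t : ℂ) * (b - a) ∈ U := by
    intro t ht
    have := hU.add_smul_sub_mem ha hb ht
    rwa [Complex.real_smul] at this
  -- Dividing by `b - a` makes the derivative along the segment equal to `F'`; its real part would
  -- vanish somewhere by Rolle's theorem.
  have hder : ∀ t ∈ Icc (0 : ℝ) 1, HasDerivAt (fun t : ℝ => (F (a + (t : ℂ) * (b - a)) / (b - a)).re)
      (F' (a + (t : ℂ) * (b - a))).re t := by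
    intro t ht
    have h1 : HasDerivAt (fun s : ℂ => a + s * (b - a)) (b - a) (t : ℂ) := by
      simpa using ((hasDerivAt_id (t : ℂ)).mul_const (b - a)).const_add a
    have h2 := ((hF _ (hmem t ht)).comp (t : ℂ) h1).div_const (b - a)
    rw [mul_div_cancel_right₀ _ hba] at h2
    exact h2.real_of_complex
  obtain ⟨t, ht, h0⟩ := exists_hasDerivAt_eq_zero (zero_lt_one' ℝ)
    (fun t ht => (hder t ht).continuousAt.continuousWithinAt) (by simp [hab])
    (fun t ht => hder t (Ioo_subset_Icc_self ht))
  exact (hpos _ (hmem t (Ioo_subset_Icc_self ht))).ne' h0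

/-- A nonvanishing analytic function in the unit disk has an analytic logarithm. -/
theorem exists_eq_const_mul_exp {h : ℂ → ℂ} (hh : DifferentiableOn ℂ h unitDisk)
    (hne : ∀ z ∈ unitDisk, h z ≠ 0) :
    ∃ q : ℂ → ℂ, ∃ C : ℂ, C ≠ 0 ∧ ∀ z ∈ unitDisk,
      HasDerivAt q (logDeriv h z) z ∧ h z = C * exp (q z) := by
  have hl : DifferentiableOn ℂ (logDeriv h) unitDisk := (hh.deriv isOpen_unitDisk).div hh hne
  obtain ⟨q, hq⟩ := hl.isExactOn_ball
  have h0 : (0 : ℂ) ∈ unitDisk := mem_unitDisk.2 (by simp)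
  -- With `q` a primitive of `h'/h`, the product `h * exp (-q)` has zero derivative.
  have hconst : ∀ z ∈ unitDisk, HasDerivAt (fun z => h z * exp (-q z)) 0 z := by
    intro z hz
    have h1 := (hh.differentiableAt (isOpen_unitDisk.mem_nhds hz)).hasDerivAt
    refine (h1.mul (hq z hz).neg.cexp).congr_deriv ?_
    have := hne z hz
    rw [logDeriv_apply]
    field_simp
    ring
  refine ⟨q, h 0 * exp (-q 0), mul_ne_zero (hne 0 h0) (exp_ne_zero _), fun z hz => ⟨hq z hz, ?_⟩⟩
  have := (convex_ball (0 : ℂ) 1).is_const_of_fderivWithin_eq_zero (𝕜 := ℂ)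
    (fun z hz => (hconst z hz).differentiableAt.differentiableWithinAt) (fun z hz => by
      rw [fderivWithin_of_isOpen isOpen_ball hz, (hconst z hz).hasFDerivAt.fderiv]
      ext; simp) h0 hz
  rw [this, mul_assoc, ← exp_add]
  simp

/-- Starlike functions are univalent. -/
theorem injOn_of_re_one_add_mul_logDeriv_pos {h : ℂ → ℂ} (hh : DifferentiableOn ℂ h unitDisk)
    (hne : ∀ z ∈ unitDisk, h z ≠ 0) (hpos : ∀ z ∈ unitDisk, 0 < (1 + z * logDeriv h z).re) :
    InjOn (fun z => z * h z) unitDisk := by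
  obtain ⟨q, C, hC, hq⟩ := exists_eq_const_mul_exp hh hne
  have hmem : ∀ z : ℂ, z ∈ {z : ℂ | z.re < 0} → exp z ∈ unitDisk := by
    intro z hz
    rw [mem_unitDisk, Complex.norm_exp]
    exact Real.exp_lt_one_iff.2 hz
  -- In the coordinate `z = exp ζ`, this function is a logarithm of `z * h z` up to a constant. Its
  -- derivative is `1 + z h'/h`, so Noshiro–Warschawski applies on the left half-plane.
  have hinj : InjOn (fun z => z + q (exp z)) {z : ℂ | z.re < 0} := by
    refine injOn_of_re_deriv_pos (convex_halfSpace_re_lt 0)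
      (F' := fun z => 1 + exp z * logDeriv h (exp z)) (fun z hz => ?_)
      (fun z hz => hpos _ (hmem z hz))
    refine ((hasDerivAt_id z).add ((hq _ (hmem z hz)).1.comp z (hasDerivAt_exp z))).congr_deriv ?_
    ring
  intro z hz w hw hzw
  simp only at hzw
  rcases eq_or_ne z 0 with rfl | hz0
  · have : w = 0 := by simpa [hne w hw] using hzw.symm
    exact this.symm
  have hw0 : w ≠ 0 := by
    rintro rfl
    simp [hz0, hne z hz] at hzw
  have hlog : ∀ u ∈ unitDisk, u ≠ 0 → (log u).re < 0 := by
    intro u hu hu0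
    rw [log_re]
    exact Real.log_neg (norm_pos_iff.2 hu0) (mem_unitDisk.1 hu)
  have hexp : exp (log z + q z) = exp (log w + q w) := by
    rw [exp_add, exp_add, exp_log hz0, exp_log hw0]
    rw [(hq z hz).2, (hq w hw).2] at hzw
    apply mul_left_cancel₀ hC
    linear_combination hzw
  obtain ⟨n, hn⟩ := exp_eq_exp_iff_exists_int.1 hexp
  -- The period `2πi n` is absorbed into the choice of logarithm of `w`, which leaves its real part
  -- unchanged.
  have hw' : exp (log w + n * (2 * Real.pi * I)) = w := by
    rw [exp_add, exp_int_mul_two_pi_mul_I, mul_one, exp_log hw0]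
  have := hinj (x₁ := log z) (x₂ := log w + n * (2 * Real.pi * I)) (hlog z hz hz0)
    (by simpa using hlog w hw hw0) (by
      simp only [hw', exp_log hz0]
      linear_combination hn)
  rw [← exp_log hz0, this, hw']

/-! ### Disks inside the cardioid and subordination -/

/-- The principal square root maps the part of the cardioid given by a disk through the cusp into
the disk around one. -/
theorem norm_sub_one_lt_of_sq {u : ℂ} {a : ℝ} (hu : 0 < u.re) (ha : a ≤ 3 / 2)
    (h : ‖(1 + u ^ 2) / 2 - a‖ < a - 1 / 2) : ‖u - 1‖ < 1 := by
  have h2 : ‖(1 + u ^ 2) / 2 - (a : ℂ)‖ ^ 2 < (a - 1 / 2) ^ 2 :=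
    pow_lt_pow_left₀ h (norm_nonneg _) two_ne_zero
  have e : (1 + u ^ 2) / 2 - (a : ℂ) = (((1 + u.re ^ 2 - u.im ^ 2) / 2 - a : ℝ) : ℂ)
      + ((u.re * u.im : ℝ) : ℂ) * I := by
    conv_lhs => rw [← re_add_im u]
    push_cast
    linear_combination (u.im : ℂ) ^ 2 / 2 * I_sq
  have ha0 : 0 < a - 1 / 2 := (norm_nonneg _).trans_lt h
  rw [e, Complex.sq_norm, normSq_add_mul_I] at h2
  refine lt_of_pow_lt_pow_left₀ 2 zero_le_one ?_
  rw [Complex.sq_norm, normSq_apply]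
  simp only [sub_re, sub_im, one_re, one_im, sub_zero, one_pow]
  set x := u.re
  set y := u.im
  by_contra! hc
  -- The assumption `|u - 1| ≥ 1` reads `|u|² ≥ 2x`, hence `|u|⁴ ≥ 4x²`. The disk condition reads
  -- `|u|⁴ < 2(2a - 1) Re u²`, which is at most `4(x² - y²)` because `a ≤ 3/2`: a contradiction.
  have hN : 2 * x ≤ x ^ 2 + y ^ 2 := by nlinarith
  have hv : (x ^ 2 + y ^ 2) ^ 2 < 2 * (2 * a - 1) * (x ^ 2 - y ^ 2) := by nlinarith
  have hxy : 0 < x ^ 2 - y ^ 2 := by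
    by_contra! hneg
    nlinarith [sq_nonneg (x ^ 2 + y ^ 2), mul_nonneg ha0.le (neg_nonneg.2 hneg)]
  have hv' : (x ^ 2 + y ^ 2) ^ 2 < 4 * (x ^ 2 - y ^ 2) := by nlinarith
  have hx2 : x < 2 := by nlinarith [sq_nonneg y, sq_nonneg (x ^ 2 + y ^ 2), sq_nonneg (x * y)]
  nlinarith [mul_le_mul hN hN (by positivity) (by positivity)]

/-- A function with values in real-centred disks to the right of the cusp is subordinate to the
cardioid map. -/
theorem subordinate_phiCar {F Q : ℂ → ℂ} (hQ : DifferentiableOn ℂ Q unitDisk) (hQ0 : Q 0 = 1)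
    (hFQ : ∀ z ∈ unitDisk, F z = Q z)
    (hd : ∀ z ∈ unitDisk, ∃ a : ℝ, a ≤ 3 / 2 ∧ ‖Q z - a‖ < a - 1 / 2) :
    Subordinate F phiCar := by
  have hre : ∀ z ∈ unitDisk, 0 < (2 * Q z - 1).re := by
    intro z hz
    obtain ⟨a, -, h⟩ := hd z hz
    have := (abs_lt.1 ((Complex.abs_re_le_norm _).trans_lt h)).1
    simp at this ⊢
    linarith
  have hsq : ∀ z : ℂ, ((2 * Q z - 1) ^ (1 / 2 : ℂ)) ^ 2 = 2 * Q z - 1 := by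
    intro z
    rw [one_div]
    exact Complex.cpow_ofNat_inv_pow _ 2
  have hsre : ∀ z ∈ unitDisk, 0 < ((2 * Q z - 1) ^ (1 / 2 : ℂ)).re := by
    intro z hz
    have hne : 2 * Q z - 1 ≠ 0 := fun h => by simpa [h] using hre z hz
    rw [cpow_def_of_ne_zero hne, exp_re]
    refine mul_pos (Real.exp_pos _) (Real.cos_pos_of_mem_Ioo ?_)
    have harg := Complex.abs_arg_lt_pi_div_two_iff.2 (Or.inl (hre z hz))
    have him : (log (2 * Q z - 1) * (1 / 2)).im = (2 * Q z - 1).arg / 2 := by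
      rw [mul_one_div, show (2 : ℂ) = ((2 : ℝ) : ℂ) by norm_num, Complex.div_ofReal_im, log_im]
    rw [him]
    obtain ⟨h1, h2⟩ := abs_lt.1 harg
    constructor <;> linarith [Real.pi_pos]
  -- Solving `1 + w + w²/2 = Q` gives `(1 + w)² = 2Q - 1`; the principal root is analytic because
  -- `Re (2Q - 1) > 0`.
  refine ⟨fun z => (2 * Q z - 1) ^ (1 / 2 : ℂ) - 1, ?_, ?_, ?_, ?_⟩
  · refine DifferentiableOn.sub_const (DifferentiableOn.cpow_const ?_ fun z hz =>
      Or.inl (hre z hz)) 1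
    exact (hQ.const_mul 2).sub_const 1
  · intro z hz
    obtain ⟨a, ha, h⟩ := hd z hz
    refine mem_unitDisk.2 (norm_sub_one_lt_of_sq (hsre z hz) ha ?_)
    rw [hsq]
    convert h using 3
    ring
  · norm_num [hQ0]
  · intro z hz
    rw [hFQ z hz, phiCar]
    linear_combination -(hsq z) / 2

theorem dslope_zero_mul {f : ℂ → ℂ} (h0 : f 0 = 0) (z : ℂ) : z * dslope f 0 z = f z := by
  simpa [h0] using sub_smul_dslope f 0 z

theorem differentiableOn_dslope_unitDisk {f : ℂ → ℂ} (hf : f ∈ ClassA) :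
    DifferentiableOn ℂ (dslope f 0) unitDisk :=
  (Complex.differentiableOn_dslope (isOpen_unitDisk.mem_nhds (mem_unitDisk.2 (by simp)))).2 hf.1

/-- Writing `f z = z * h z` turns the quotient into `1 + z h'/h`, which is analytic at the origin
too. The disks lie in `Re > 1/2`, so univalence comes from the same hypothesis as the subordination.
-/
theorem mem_starlikeCar {f : ℂ → ℂ} (hf : f ∈ ClassA)
    (hne : ∀ z ∈ unitDisk, z ≠ 0 → f z ≠ 0)
    (hd : ∀ z ∈ unitDisk, z ≠ 0 →
      ∃ a : ℝ, a ≤ 3 / 2 ∧ ‖z * logDeriv f z - a‖ < a - 1 / 2) :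
    f ∈ StarlikeCar := by
  have hmul := dslope_zero_mul hf.2.1
  have hhd := differentiableOn_dslope_unitDisk hf
  set h := dslope f 0 with hh
  have hne' : ∀ z ∈ unitDisk, h z ≠ 0 := by
    intro z hz
    rcases eq_or_ne z 0 with rfl | hz0
    · simp [hh, hf.2.2]
    · intro h0
      exact hne z hz hz0 (by rw [← hmul, h0, mul_zero])
  have hfeq : f = fun z => z * h z := funext fun z => (hmul z).symm
  have hQ : ∀ z ∈ unitDisk, z ≠ 0 → z * logDeriv f z = 1 + z * logDeriv h z := by
    intro z hz hz0
    rw [hfeq, logDeriv_mul (f := fun z => z) z hz0 (hne' z hz) differentiableAt_id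
      (hhd.differentiableAt (isOpen_unitDisk.mem_nhds hz)), logDeriv_id', mul_add,
      mul_one_div_cancel hz0]
  have hd' : ∀ z ∈ unitDisk, ∃ a : ℝ, a ≤ 3 / 2 ∧ ‖1 + z * logDeriv h z - a‖ < a - 1 / 2 := by
    intro z hz
    rcases eq_or_ne z 0 with rfl | hz0
    · exact ⟨1, by norm_num, by norm_num⟩
    · rw [← hQ z hz hz0]
      exact hd z hz hz0
  refine ⟨⟨hf, ?_⟩, subordinate_phiCar (Q := fun z => 1 + z * logDeriv h z) ?_ (by simp) ?_ hd'⟩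
  · rw [hfeq]
    refine injOn_of_re_one_add_mul_logDeriv_pos hhd hne' fun z hz => ?_
    obtain ⟨a, -, h⟩ := hd' z hz
    have := (abs_lt.1 ((Complex.abs_re_le_norm _).trans_lt h)).1
    rw [sub_re, ofReal_re] at this
    linarith
  · exact (differentiableOn_id.mul ((hhd.deriv isOpen_unitDisk).div hhd hne')).const_add 1
  · intro z hz
    rw [logDerivQuotient]
    split_ifs with hz0
    · simp [hz0]
    · rw [← hQ z hz hz0, logDeriv_apply, mul_div_assoc]

/-! ### Dilations and sharp radii -/

theorem norm_ofReal_mul_lt {r : ℝ} (hr : 0 < r) {z : ℂ} (hz : z ∈ unitDisk) :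
    ‖(r : ℂ) * z‖ < r := by
  rw [norm_mul, Complex.norm_real, Real.norm_of_nonneg hr.le]
  exact mul_lt_of_lt_one_right hr (mem_unitDisk.1 hz)

theorem deriv_dilation {r : ℝ} (hr : 0 < r) (f : ℂ → ℂ) (z : ℂ) :
    deriv (dilation r f) z = deriv f (r * z) := by
  have hr0 : (r : ℂ) ≠ 0 := ofReal_ne_zero.2 hr.ne'
  have : dilation r f = fun z => f (r * z) / r := rfl
  rw [this, deriv_div_const, deriv_comp_mul_left, smul_eq_mul, mul_div_cancel_left₀ _ hr0]

theorem dilation_mem_classA {f : ℂ → ℂ} (hf : f ∈ ClassA) {r : ℝ} (hr : 0 < r) (hr1 : r ≤ 1) :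
    dilation r f ∈ ClassA := by
  refine ⟨?_, by simp [dilation, hf.2.1], by rw [deriv_dilation hr, mul_zero, hf.2.2]⟩
  exact (hf.1.comp (by fun_prop) fun z hz =>
    mem_unitDisk.2 ((norm_ofReal_mul_lt hr hz).trans_le hr1)).div_const _

theorem mul_logDeriv_dilation {r : ℝ} (hr : 0 < r) (f : ℂ → ℂ) (z : ℂ) :
    z * logDeriv (dilation r f) z = (r * z) * logDeriv f (r * z) := by
  have hr0 : (r : ℂ) ≠ 0 := ofReal_ne_zero.2 hr.ne'
  rw [logDeriv_apply, logDeriv_apply, deriv_dilation hr, dilation]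
  field_simp

theorem dilation_mem_starlikeCar {f : ℂ → ℂ} (hf : f ∈ ClassA) {R : ℝ} (hR : R ≤ 1)
    (hd : ∀ z : ℂ, z ≠ 0 → ‖z‖ < R →
      f z ≠ 0 ∧ ∃ a : ℝ, a ≤ 3 / 2 ∧ ‖z * logDeriv f z - a‖ < a - 1 / 2)
    {r : ℝ} (hr : 0 < r) (hrR : r ≤ R) : dilation r f ∈ StarlikeCar := by
  have hr0 : (r : ℂ) ≠ 0 := ofReal_ne_zero.2 hr.ne'
  have key := fun z (hz : z ∈ unitDisk) (hz0 : z ≠ 0) =>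
    hd (r * z) (mul_ne_zero hr0 hz0) ((norm_ofReal_mul_lt hr hz).trans_le hrR)
  refine mem_starlikeCar (dilation_mem_classA hf hr (hrR.trans hR)) ?_ ?_
  · exact fun z hz hz0 => div_ne_zero (key z hz hz0).1 hr0
  · intro z hz hz0
    rw [mul_logDeriv_dilation hr]
    exact (key z hz hz0).2

/-- The cusp of the cardioid is not in the image of the open disk. -/
theorem phiCar_ne_half {z : ℂ} (hz : z ∈ unitDisk) : phiCar z ≠ 1 / 2 := by
  intro h
  have : (1 + z) ^ 2 = 0 := by
    rw [phiCar] at h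
    linear_combination 2 * h
  exact one_add_ne_zero_of_norm_lt (mem_unitDisk.1 hz) (pow_eq_zero_iff two_ne_zero |>.1 this)

/-- For `r > |z₀|` the point `z₀ / r` is interior to the unit disk, and there the quotient of the
dilation takes the omitted cusp value. One such point therefore rules out all larger radii at once.
-/
theorem dilation_notMem_starlikeCar {f : ℂ → ℂ} {z₀ : ℂ} (hz₀ : z₀ ≠ 0)
    (h : z₀ * logDeriv f z₀ = 1 / 2) {r : ℝ} (hr : ‖z₀‖ < r) : dilation r f ∉ StarlikeCar := by
  rintro ⟨-, w, -, hm, -, hw⟩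
  have hr0 : 0 < r := (norm_nonneg _).trans_lt hr
  have hrc : (r : ℂ) ≠ 0 := ofReal_ne_zero.2 hr0.ne'
  have hz : z₀ / r ∈ unitDisk := by
    rw [mem_unitDisk, norm_div, Complex.norm_real, Real.norm_of_nonneg hr0.le]
    exact (div_lt_one hr0).2 hr
  have hne : z₀ / r ≠ 0 := div_ne_zero hz₀ hrc
  refine phiCar_ne_half (hm hz) ?_
  rw [← hw _ hz, logDerivQuotient, if_neg hne, mul_div_assoc, ← logDeriv_apply,
    mul_logDeriv_dilation hr0, mul_div_cancel₀ _ hrc, h]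

theorem isSharpRadius_starlikeCar {F : Set (ℂ → ℂ)} {R : ℝ} (hR0 : 0 < R) (hR1 : R ≤ 1)
    (hF : ∀ f ∈ F, f ∈ ClassA ∧ ∀ z : ℂ, z ≠ 0 → ‖z‖ < R →
      f z ≠ 0 ∧ ∃ a : ℝ, a ≤ 3 / 2 ∧ ‖z * logDeriv f z - a‖ < a - 1 / 2)
    (hsharp : ∃ f ∈ F, ∃ z : ℂ, ‖z‖ = R ∧ z * logDeriv f z = 1 / 2) :
    IsSharpRadius StarlikeCar F R := by
  obtain ⟨f₀, hf₀, z₀, hz₀, hval⟩ := hsharp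
  have hz₀0 : z₀ ≠ 0 := norm_pos_iff.1 (hz₀ ▸ hR0)
  have hnot : ∀ r : ℝ, R < r → r ≤ 1 → dilation r f₀ ∉ StarlikeCar := fun r hr _ =>
    dilation_notMem_starlikeCar hz₀0 hval (hz₀ ▸ hr)
  refine ⟨⟨⟨hR0, hR1, fun f hf r hr hrR =>
    dilation_mem_starlikeCar (hF f hf).1 hR1 (hF f hf).2 hr hrR⟩, ?_⟩, f₀, hf₀, hnot⟩
  rintro ρ ⟨hρ0, hρ1, hρ⟩
  by_contra! hlt
  exact hnot ρ hlt hρ1 (hρ f₀ hf₀ ρ hρ0 le_rfl)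

/-! ### Ratios of normalized functions -/

/-- Cancelling a factor `z` from numerator and denominator, via `dslope`, removes the singularity of
`f / g` at the origin. -/
theorem exists_ratio {f g : ℂ → ℂ} (hf : f ∈ ClassA) (hg : g ∈ ClassA)
    (hne : ∀ z ∈ unitDisk, z ≠ 0 → g z ≠ 0) :
    ∃ p : ℂ → ℂ, DifferentiableOn ℂ p unitDisk ∧ p 0 = 1 ∧
      (∀ z ∈ unitDisk, z ≠ 0 → p z = f z / g z) ∧
      ∀ z ∈ unitDisk, z ≠ 0 → f z ≠ 0 → z * logDeriv f z = z * logDeriv p z + z * logDeriv g z := by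
  have hgne : ∀ z ∈ unitDisk, dslope g 0 z ≠ 0 := by
    intro z hz
    rcases eq_or_ne z 0 with rfl | hz0
    · simp [hg.2.2]
    · intro h0
      exact hne z hz hz0 (by rw [← dslope_zero_mul hg.2.1, h0, mul_zero])
  have hpd : DifferentiableOn ℂ (fun z => dslope f 0 z / dslope g 0 z) unitDisk :=
    (differentiableOn_dslope_unitDisk hf).div (differentiableOn_dslope_unitDisk hg) hgne
  have hp : ∀ z : ℂ, z ≠ 0 → dslope f 0 z / dslope g 0 z = f z / g z := by
    intro z hz0
    rw [← dslope_zero_mul hf.2.1 z, ← dslope_zero_mul hg.2.1 z, mul_div_mul_left _ _ hz0]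
  refine ⟨_, hpd, by simp [hf.2.2, hg.2.2], fun z _ hz0 => hp z hz0, fun z hz hz0 hfz => ?_⟩
  have hgz := hne z hz hz0
  have heq : f =ᶠ[nhds z] fun z => (dslope f 0 z / dslope g 0 z) * g z := by
    filter_upwards [isOpen_unitDisk.mem_nhds hz, isOpen_ne.mem_nhds hz0] with w hw hw0
    rw [hp w hw0, div_mul_cancel₀ _ (hne w hw hw0)]
  rw [← mul_add, ← logDeriv_mul z (by rw [hp z hz0]; exact div_ne_zero hfz hgz) hgz
    (hpd.differentiableAt (isOpen_unitDisk.mem_nhds hz))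
    (hg.1.differentiableAt (isOpen_unitDisk.mem_nhds hz)), logDeriv_apply, logDeriv_apply,
    heq.deriv_eq, ← heq.eq_of_nhds]

theorem RatioPos.ne_zero {f g : ℂ → ℂ} (h : RatioPos f g) {z : ℂ} (hz : z ∈ unitDisk)
    (hz0 : z ≠ 0) : f z ≠ 0 ∧ g z ≠ 0 := by
  have := h z hz hz0
  constructor <;> intro h0 <;> simp [h0] at this

/-- If either function vanishes, the Lean quotient is `0`, at distance exactly `1` from `1`, so the
strict inequality fails. -/
theorem RatioNearOne.ne_zero {f g : ℂ → ℂ} (h : RatioNearOne f g) {z : ℂ} (hz : z ∈ unitDisk)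
    (hz0 : z ≠ 0) : f z ≠ 0 ∧ g z ≠ 0 := by
  have := h z hz hz0
  constructor <;> intro h0 <;> simp [h0] at this

theorem RatioPos.norm_sub_le {f g : ℂ → ℂ} (hf : f ∈ ClassA) (hg : g ∈ ClassA)
    (h : RatioPos f g) {z : ℂ} (hz : z ∈ unitDisk) (hz0 : z ≠ 0) :
    ‖z * logDeriv f z - z * logDeriv g z‖ ≤ 2 * ‖z‖ / (1 - ‖z‖ ^ 2) := by
  obtain ⟨p, hpd, hp0, hp, hl⟩ := exists_ratio hf hg fun z hz hz0 => (h.ne_zero hz hz0).2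
  rw [hl z hz hz0 (h.ne_zero hz hz0).1, add_sub_cancel_right]
  refine norm_mul_logDeriv_le_of_re_pos hpd (fun w hw => ?_) hz
  rcases eq_or_ne w 0 with rfl | hw0
  · simp [hp0]
  · rw [hp w hw hw0]
    exact h w hw hw0

theorem RatioNearOne.norm_sub_le {f g : ℂ → ℂ} (hf : f ∈ ClassA) (hg : g ∈ ClassA)
    (h : RatioNearOne f g) {z : ℂ} (hz : z ∈ unitDisk) (hz0 : z ≠ 0) :
    ‖z * logDeriv f z - z * logDeriv g z‖ ≤ (‖z‖ + ‖z‖ ^ 2) / (1 - ‖z‖ ^ 2) := by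
  obtain ⟨p, hpd, hp0, hp, hl⟩ := exists_ratio hf hg fun z hz hz0 => (h.ne_zero hz hz0).2
  rw [hl z hz hz0 (h.ne_zero hz hz0).1, add_sub_cancel_right]
  refine norm_mul_logDeriv_le_of_norm_sub_one_lt hpd (fun w hw => ?_) hp0 hz
  rcases eq_or_ne w 0 with rfl | hw0
  · simp [hp0]
  · rw [hp w hw hw0]
    exact h w hw hw0

/-- Multiplication by an analytic function with value `1` at the origin preserves `ClassA`. -/
theorem mul_mem_classA {p g : ℂ → ℂ} (hp : DifferentiableOn ℂ p unitDisk) (hp0 : p 0 = 1)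
    (hg : g ∈ ClassA) : (fun z => p z * g z) ∈ ClassA := by
  have h0 : (0 : ℂ) ∈ unitDisk := mem_unitDisk.2 (by simp)
  refine ⟨hp.mul hg.1, by simp [hg.2.1], ?_⟩
  rw [deriv_fun_mul (hp.differentiableAt (isOpen_unitDisk.mem_nhds h0))
    (hg.1.differentiableAt (isOpen_unitDisk.mem_nhds h0)), hg.2.1, hg.2.2, hp0]
  simp

/-! ### Extremal factors -/

/-- The Möbius map of the unit disk onto the right half-plane, precomposed with `z ↦ -κ z`. -/
noncomputable def halfPlaneMap (κ z : ℂ) : ℂ := (1 - κ * z) / (1 + κ * z)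

section Extremal

variable {κ z : ℂ}

theorem norm_mul_lt_one_of_mem_unitDisk (hκ : ‖κ‖ = 1) (hz : z ∈ unitDisk) : ‖κ * z‖ < 1 := by
  rw [norm_mul, hκ, one_mul]
  exact mem_unitDisk.1 hz

theorem halfPlaneMap_re_pos (hκ : ‖κ‖ = 1) (hz : z ∈ unitDisk) : 0 < (halfPlaneMap κ z).re := by
  have h1 := norm_mul_lt_one_of_mem_unitDisk hκ hz
  have hre : (halfPlaneMap κ z).re = (1 - ‖κ * z‖ ^ 2) / ‖1 + κ * z‖ ^ 2 := by
    simp only [halfPlaneMap, Complex.div_re, Complex.sq_norm, normSq_apply, add_re, add_im, sub_re,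
      sub_im, one_re, one_im]
    ring
  rw [hre]
  have h2 := norm_pos_iff.2 (one_add_ne_zero_of_norm_lt h1)
  have : 0 < 1 - ‖κ * z‖ ^ 2 := by nlinarith [norm_nonneg (κ * z)]
  positivity

theorem differentiableOn_halfPlaneMap (hκ : ‖κ‖ = 1) :
    DifferentiableOn ℂ (halfPlaneMap κ) unitDisk :=
  DifferentiableOn.div (by fun_prop) (by fun_prop) fun _ hz =>
    one_add_ne_zero_of_norm_lt (norm_mul_lt_one_of_mem_unitDisk hκ hz)

theorem halfPlaneMap_zero : halfPlaneMap κ 0 = 1 := by simp [halfPlaneMap]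

theorem hasDerivAt_one_sub_mul : HasDerivAt (fun z => 1 - κ * z) (-κ) z := by
  simpa using ((hasDerivAt_id z).const_mul κ).const_sub 1

theorem hasDerivAt_one_add_mul : HasDerivAt (fun z => 1 + κ * z) κ z := by
  simpa using ((hasDerivAt_id z).const_mul κ).const_add 1

theorem mul_logDeriv_one_sub_mul {s : ℝ} (h : κ * z = s) :
    z * logDeriv (fun z => 1 - κ * z) z = ((-s / (1 - s) : ℝ) : ℂ) := by
  rw [logDeriv_apply, hasDerivAt_one_sub_mul.deriv, h]
  push_cast
  rw [← mul_div_assoc, mul_neg, mul_comm z, h]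

theorem mul_logDeriv_halfPlaneMap (hκ : ‖κ‖ = 1) (hz : z ∈ unitDisk) {s : ℝ} (h : κ * z = s) :
    z * logDeriv (halfPlaneMap κ) z = ((-(2 * s / (1 - s ^ 2)) : ℝ) : ℂ) := by
  have h1 := norm_mul_lt_one_of_mem_unitDisk hκ hz
  have ha := one_add_ne_zero_of_norm_lt h1
  have hb := one_sub_ne_zero_of_norm_lt h1
  have : logDeriv (halfPlaneMap κ) z = -κ / (1 - κ * z) - κ / (1 + κ * z) := by
    have e : halfPlaneMap κ = fun z => (1 - κ * z) / (1 + κ * z) := rfl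
    rw [e, logDeriv_div z hb ha hasDerivAt_one_sub_mul.differentiableAt
      hasDerivAt_one_add_mul.differentiableAt, logDeriv_apply, logDeriv_apply,
      hasDerivAt_one_sub_mul.deriv, hasDerivAt_one_add_mul.deriv]
  have e2 : z * (-κ / (1 - κ * z) - κ / (1 + κ * z)) =
      -(κ * z) / (1 - κ * z) - (κ * z) / (1 + κ * z) := by ring
  rw [this, e2]
  rw [h] at ha hb ⊢
  push_cast
  rw [show (1 : ℂ) - (s : ℂ) ^ 2 = (1 - s) * (1 + s) by ring]
  field_simp
  ring

end Extremal

/-! ### Reduction to a real contact equation -/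

/-- A function whose logarithmic derivative `z χ'(z) / χ(z)` lies, on small circles `|z| = s`, in a
disk with leftmost point `m s`, which is attained at `s η`. -/
structure HasCarMinimum (χ : ℂ → ℂ) (m : ℝ → ℝ) (η : ℂ) : Prop where
  mem_classA : χ ∈ ClassA
  ne_zero : ∀ z ∈ unitDisk, z ≠ 0 → χ z ≠ 0
  norm_eq_one : ‖η‖ = 1
  disk : ∀ z : ℂ, z ≠ 0 → ‖z‖ < 1 / 4 → ∃ a : ℝ, a ≤ 3 / 2 ∧ ‖z * logDeriv χ z - a‖ ≤ a - m ‖z‖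
  attained : ∀ s : ℝ, 0 < s → s < 1 / 4 → s * η * logDeriv χ (s * η) = m s

/-- `R` is the first point at which the error term `ε` reaches `m - 1 / 2`. -/
structure IsFirstContact (m ε : ℝ → ℝ) (R : ℝ) : Prop where
  pos : 0 < R
  lt : R < 1 / 4
  before : ∀ s, 0 < s → s < R → ε s < m s - 1 / 2
  contact : ε R = m R - 1 / 2

/-- Enlarging the disk for `χ` by `ε` keeps its leftmost point right of the cusp before contact; at
contact the extremal function hits the cusp at `R * η`. -/
theorem HasCarMinimum.isSharpRadius {χ : ℂ → ℂ} {m ε : ℝ → ℝ} {η : ℂ} {R : ℝ} {F : Set (ℂ → ℂ)}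
    (h : HasCarMinimum χ m η) (hR : IsFirstContact m ε R)
    (hF : ∀ f ∈ F, f ∈ ClassA ∧ ∀ z ∈ unitDisk, z ≠ 0 →
      f z ≠ 0 ∧ ‖z * logDeriv f z - z * logDeriv χ z‖ ≤ ε ‖z‖)
    (hext : ∃ f ∈ F, ∀ s : ℝ, 0 < s → s < 1 →
      s * η * logDeriv f (s * η) = s * η * logDeriv χ (s * η) - ε s) :
    IsSharpRadius StarlikeCar F R := by
  have hR1 : R < 1 := hR.lt.trans (by norm_num)
  refine isSharpRadius_starlikeCar hR.pos hR1.le (fun f hf => ⟨(hF f hf).1, fun z hz0 hzR => ?_⟩) ?_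
  · obtain ⟨hfz, hle⟩ := (hF f hf).2 z (mem_unitDisk.2 (hzR.trans hR1)) hz0
    obtain ⟨a, ha, hχ⟩ := h.disk z hz0 (hzR.trans hR.lt)
    refine ⟨hfz, a, ha, ?_⟩
    have := norm_sub_le_norm_sub_add_norm_sub (z * logDeriv f z) (z * logDeriv χ z) (a : ℂ)
    linarith [hR.before ‖z‖ (norm_pos_iff.2 hz0) hzR]
  · obtain ⟨f, hf, hval⟩ := hext
    refine ⟨f, hf, R * η, ?_, ?_⟩
    · rw [norm_mul, h.norm_eq_one, Complex.norm_real, Real.norm_of_nonneg hR.pos.le, mul_one]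
    · rw [hval R hR.pos hR1, h.attained R hR.pos hR.lt, hR.contact]
      push_cast
      ring

theorem HasCarMinimum.hasCarRadii {χ : ℂ → ℂ} {m : ℝ → ℝ} {η : ℂ} {R₁ R₂ R₃ : ℝ}
    (h : HasCarMinimum χ m η)
    (h₁ : IsFirstContact m (fun s => 4 * s / (1 - s ^ 2)) R₁)
    (h₂ : IsFirstContact m (fun s => (3 * s + s ^ 2) / (1 - s ^ 2)) R₂)
    (h₃ : IsFirstContact m (fun s => 2 * s / (1 - s ^ 2)) R₃) :
    HasCarRadii χ R₁ R₂ R₃ := by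
  -- With this rotation `κ z = s` at `z = s η`, which is where the extremal factors have their most
  -- negative logarithmic derivative.
  set κ := conj η with hκdef
  have hκ : ‖κ‖ = 1 := by rw [hκdef, Complex.norm_conj, h.norm_eq_one]
  have hκη : ∀ s : ℝ, κ * (s * η) = s := by
    intro s
    have : κ * η = 1 := by rw [hκdef, Complex.conj_mul', h.norm_eq_one]; simp
    linear_combination (s : ℂ) * this
  have hmem : ∀ s : ℝ, 0 < s → s < 1 → (s * η : ℂ) ∈ unitDisk := by
    intro s hs hs1
    rwa [mem_unitDisk, norm_mul, h.norm_eq_one, Complex.norm_real, Real.norm_of_nonneg hs.le,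
      mul_one]
  have hne : ∀ s : ℝ, 0 < s → (s * η : ℂ) ≠ 0 := by
    intro s hs
    refine mul_ne_zero (ofReal_ne_zero.2 hs.ne') fun h0 => ?_
    simpa [h0] using h.norm_eq_one
  set p := halfPlaneMap κ with hp
  have hpd := differentiableOn_halfPlaneMap hκ
  have hpne : ∀ z ∈ unitDisk, p z ≠ 0 := fun z hz h0 => by
    simpa [← hp, h0] using halfPlaneMap_re_pos hκ hz
  have hld : DifferentiableOn ℂ (fun z => 1 - κ * z) unitDisk := by fun_prop
  have hlne : ∀ z ∈ unitDisk, 1 - κ * z ≠ 0 := fun z hz =>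
    one_sub_ne_zero_of_norm_lt (norm_mul_lt_one_of_mem_unitDisk hκ hz)
  have hpos : ∀ g : ℂ → ℂ, (∀ z ∈ unitDisk, z ≠ 0 → g z ≠ 0) → RatioPos (fun z => p z * g z) g := by
    intro g hg z hz hz0
    simp only [mul_div_cancel_right₀ _ (hg z hz hz0)]
    exact halfPlaneMap_re_pos hκ hz
  have hnear : ∀ g : ℂ → ℂ, (∀ z ∈ unitDisk, z ≠ 0 → g z ≠ 0) →
      RatioNearOne (fun z => (1 - κ * z) * g z) g := by
    intro g hg z hz hz0
    simp only [mul_div_cancel_right₀ _ (hg z hz hz0)]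
    rw [sub_sub_cancel_left, norm_neg]
    exact norm_mul_lt_one_of_mem_unitDisk hκ hz
  have hmul : ∀ q g : ℂ → ℂ, DifferentiableOn ℂ q unitDisk → (∀ z ∈ unitDisk, q z ≠ 0) →
      g ∈ ClassA → (∀ z ∈ unitDisk, z ≠ 0 → g z ≠ 0) → ∀ s : ℝ, 0 < s → s < 1 →
      s * η * logDeriv (fun z => q z * g z) (s * η) =
        s * η * logDeriv q (s * η) + s * η * logDeriv g (s * η) := by
    intro q g hq hqne hg hgne s hs hs1
    have hs' := hmem s hs hs1
    rw [logDeriv_mul _ (hqne _ hs') (hgne _ hs' (hne s hs))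
      (hq.differentiableAt (isOpen_unitDisk.mem_nhds hs'))
      (hg.1.differentiableAt (isOpen_unitDisk.mem_nhds hs')), mul_add]
  have hgA : (fun z => p z * χ z) ∈ ClassA := mul_mem_classA hpd halfPlaneMap_zero h.mem_classA
  have hgne : ∀ z ∈ unitDisk, z ≠ 0 → p z * χ z ≠ 0 := fun z hz hz0 =>
    mul_ne_zero (hpne z hz) (h.ne_zero z hz hz0)
  have hsq : ∀ s : ℝ, 0 < s → s < 1 → (1 - s ^ 2) = (1 - s) * (1 + s) ∧ 1 - s ≠ 0 ∧ 1 + s ≠ 0 :=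
    fun s hs hs1 => ⟨by ring, by linarith, by linarith⟩
  refine ⟨h.isSharpRadius h₁ ?_ ?_, h.isSharpRadius h₂ ?_ ?_, h.isSharpRadius h₃ ?_ ?_⟩
  · rintro f ⟨hf, g, hg, hfg, hgχ⟩
    refine ⟨hf, fun z hz hz0 => ⟨(hfg.ne_zero hz hz0).1, ?_⟩⟩
    refine (norm_sub_le_norm_sub_add_norm_sub _ (z * logDeriv g z) _).trans ((add_le_add
      (hfg.norm_sub_le hf hg hz hz0) (hgχ.norm_sub_le hg h.mem_classA hz hz0)).trans_eq ?_)
    ring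
  -- Extremal function `p² χ`, with `g = p χ`.
  · refine ⟨_, ⟨mul_mem_classA hpd halfPlaneMap_zero hgA, _, hgA, hpos _ hgne,
      hpos _ h.ne_zero⟩, fun s hs hs1 => ?_⟩
    rw [hmul p _ hpd hpne hgA hgne s hs hs1, hmul p _ hpd hpne h.mem_classA h.ne_zero s hs hs1,
      mul_logDeriv_halfPlaneMap hκ (hmem s hs hs1) (hκη s)]
    push_cast
    ring
  · rintro f ⟨hf, g, hg, hfg, hgχ⟩
    refine ⟨hf, fun z hz hz0 => ⟨(hfg.ne_zero hz hz0).1, ?_⟩⟩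
    refine (norm_sub_le_norm_sub_add_norm_sub _ (z * logDeriv g z) _).trans ((add_le_add
      (hfg.norm_sub_le hf hg hz hz0) (hgχ.norm_sub_le hg h.mem_classA hz hz0)).trans_eq ?_)
    ring
  -- Extremal function `(1 - κ z) p χ`, with `g = p χ`. The bound is exact as `s/(1 - s) = (s +
  -- s²)/(1 - s²)`.
  · refine ⟨_, ⟨mul_mem_classA hld (by simp) hgA, _, hgA, hnear _ hgne,
      hpos _ h.ne_zero⟩, fun s hs hs1 => ?_⟩
    rw [hmul _ _ hld hlne hgA hgne s hs hs1, hmul p _ hpd hpne h.mem_classA h.ne_zero s hs hs1,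
      mul_logDeriv_halfPlaneMap hκ (hmem s hs hs1) (hκη s), mul_logDeriv_one_sub_mul (hκη s)]
    obtain ⟨e, h1, h2⟩ := hsq s hs hs1
    have : -s / (1 - s) + -(2 * s / (1 - s ^ 2)) = -((3 * s + s ^ 2) / (1 - s ^ 2)) := by
      rw [e]
      field_simp
      ring
    rw [← add_assoc, ← ofReal_add, this]
    push_cast
    ring
  · rintro f ⟨hf, hfχ⟩
    exact ⟨hf, fun z hz hz0 => ⟨(hfχ.ne_zero hz hz0).1, hfχ.norm_sub_le hf h.mem_classA hz hz0⟩⟩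
  · refine ⟨_, ⟨hgA, hpos _ h.ne_zero⟩, fun s hs hs1 => ?_⟩
    rw [hmul p _ hpd hpne h.mem_classA h.ne_zero s hs hs1,
      mul_logDeriv_halfPlaneMap hκ (hmem s hs hs1) (hκη s)]
    push_cast
    ring

/-! ### The five functions `χ` and their disks -/

/-- This is the image of a circle about the origin under `1 / (1 - ζ)`. In the nontrivial cases `z
χ'/χ` is a real affine function of such an expression, with `ζ` one of `-z`, `z²`, `z`, `-z/2`. -/
theorem norm_inv_one_sub_sub {ζ : ℂ} (hζ : ‖ζ‖ < 1) :
    ‖1 / (1 - ζ) - ((1 / (1 - ‖ζ‖ ^ 2) : ℝ) : ℂ)‖ = ‖ζ‖ / (1 - ‖ζ‖ ^ 2) := by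
  have h1 := one_sub_ne_zero_of_norm_lt hζ
  have h2 : 0 < 1 - ‖ζ‖ ^ 2 := by nlinarith [norm_nonneg ζ]
  have h2' : ((1 - ‖ζ‖ ^ 2 : ℝ) : ℂ) ≠ 0 := ofReal_ne_zero.2 h2.ne'
  have h3 : conj (1 - ζ) = 1 - conj ζ := by simp
  have e : 1 / (1 - ζ) - ((1 / (1 - ‖ζ‖ ^ 2) : ℝ) : ℂ) =
      ζ * conj (1 - ζ) / ((1 - ζ) * ((1 - ‖ζ‖ ^ 2 : ℝ) : ℂ)) := by
    rw [ofReal_div, ofReal_one, div_sub_div _ _ h1 h2', h3]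
    congr 1
    push_cast
    linear_combination Complex.mul_conj' ζ
  have h1' := (norm_pos_iff.2 h1).ne'
  rw [e, norm_div, norm_mul, norm_mul, Complex.norm_conj, Complex.norm_real,
    Real.norm_of_nonneg h2.le]
  field_simp

theorem norm_add_mul_inv_one_sub_sub {ζ : ℂ} (hζ : ‖ζ‖ < 1) (α β : ℝ) :
    ‖α + β / (1 - ζ) - ((α + β / (1 - ‖ζ‖ ^ 2) : ℝ) : ℂ)‖ = |β| * (‖ζ‖ / (1 - ‖ζ‖ ^ 2)) := by
  rw [← norm_inv_one_sub_sub hζ, ← Real.norm_eq_abs, ← Complex.norm_real, ← norm_mul]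
  congr 1
  push_cast
  ring

theorem id_mem_classA : (fun z : ℂ => z) ∈ ClassA :=
  ⟨differentiableOn_id, rfl, deriv_id 0⟩

/-- A function `z ↦ p z * z` in terms of its nonvanishing analytic factor. -/
theorem hasCarMinimum_of_eq_mul {χ p : ℂ → ℂ} {m : ℝ → ℝ} {η : ℂ} (hχ : χ = fun z => p z * z)
    (hp : DifferentiableOn ℂ p unitDisk) (hp0 : p 0 = 1) (hne : ∀ z ∈ unitDisk, p z ≠ 0)
    (hη : ‖η‖ = 1)
    (hdisk : ∀ z : ℂ, ‖z‖ < 1 / 4 →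
      ∃ a : ℝ, a ≤ 3 / 2 ∧ ‖1 + z * logDeriv p z - a‖ ≤ a - m ‖z‖)
    (hatt : ∀ s : ℝ, 0 < s → s < 1 / 4 → 1 + s * η * logDeriv p (s * η) = m s) :
    HasCarMinimum χ m η := by
  have hlog : ∀ z : ℂ, z ≠ 0 → ‖z‖ < 1 / 4 → z * logDeriv χ z = 1 + z * logDeriv p z := by
    intro z hz0 hz
    have hz1 : z ∈ unitDisk := mem_unitDisk.2 (hz.trans (by norm_num))
    rw [hχ, logDeriv_mul (g := fun z => z) z (hne z hz1) hz0
      (hp.differentiableAt (isOpen_unitDisk.mem_nhds hz1)) differentiableAt_id, logDeriv_id',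
      mul_add, mul_one_div_cancel hz0, add_comm]
  refine ⟨hχ ▸ mul_mem_classA hp hp0 id_mem_classA, fun z hz hz0 => ?_, hη, fun z hz0 hz => ?_,
    fun s hs hs1 => ?_⟩
  · rw [hχ]
    exact mul_ne_zero (hne z hz) hz0
  · rw [hlog z hz0 hz]
    exact hdisk z hz
  · have hη0 : η ≠ 0 := by rintro rfl; simp at hη
    rw [hlog _ (mul_ne_zero (ofReal_ne_zero.2 hs.ne') hη0), hatt s hs hs1]
    rwa [norm_mul, hη, mul_one, Complex.norm_real, Real.norm_of_nonneg hs.le]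

/-- Here `z χ'/χ` is constantly `1`, so any unimodular `η` would serve. -/
theorem hasCarMinimum_id : HasCarMinimum (fun z => z) (fun _ => 1) (-1) := by
  refine hasCarMinimum_of_eq_mul (p := fun _ => 1) (by simp) (differentiableOn_const 1) rfl
    (fun _ _ => one_ne_zero) (by simp) (fun z _ => ⟨1, by norm_num, ?_⟩) (fun s _ _ => ?_)
  all_goals simp [logDeriv_apply]

theorem hasCarMinimum_div_one_add :
    HasCarMinimum (fun z => z / (1 + z)) (fun s => 1 / (1 + s)) 1 := by
  have hne : ∀ z ∈ unitDisk, 1 + z ≠ 0 := fun z hz => one_add_ne_zero_of_norm_lt (mem_unitDisk.1 hz)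
  have hl : ∀ z : ℂ, ‖z‖ < 1 / 4 → 1 + z * logDeriv (fun z => (1 + z)⁻¹) z = 1 / (1 + z) := by
    intro z hz
    have hz0 := hne z (mem_unitDisk.2 (hz.trans (by norm_num)))
    rw [logDeriv_apply, (((hasDerivAt_id' z).const_add 1).fun_inv hz0).deriv]
    field_simp
    ring
  refine hasCarMinimum_of_eq_mul (p := fun z => (1 + z)⁻¹) (by ext; ring)
    (DifferentiableOn.inv (by fun_prop) hne) (by simp) (fun z hz => inv_ne_zero (hne z hz))
    (by simp) (fun z hz => ⟨1 / (1 - ‖z‖ ^ 2), ?_, ?_⟩) (fun s hs hs1 => ?_)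
  · rw [div_le_div_iff₀ (by nlinarith [norm_nonneg z]) (by norm_num)]
    nlinarith [norm_nonneg z]
  · have := norm_inv_one_sub_sub (ζ := -z) (by rw [norm_neg]; linarith)
    rw [sub_neg_eq_add, norm_neg] at this
    rw [hl z hz, this]
    have h0 := norm_nonneg z
    have h1 : 1 - ‖z‖ ≠ 0 := by linarith
    have h2 : 1 + ‖z‖ ≠ 0 := by linarith
    rw [show 1 - ‖z‖ ^ 2 = (1 - ‖z‖) * (1 + ‖z‖) by ring]
    apply le_of_eq
    field_simp
    ring
  · rw [hl _ (by simpa [abs_of_pos hs] using hs1)]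
    push_cast
    rw [mul_one]

/-- The leftmost value of `-1 + 2/(1 - z²)` on `|z| = s` occurs where `z² = -s²`, hence the
direction `I`. -/
theorem hasCarMinimum_div_one_sub_sq :
    HasCarMinimum (fun z => z / (1 - z ^ 2)) (fun s => (1 - s ^ 2) / (1 + s ^ 2)) I := by
  have hsq : ∀ z ∈ unitDisk, ‖z ^ 2‖ < 1 := fun z hz => by
    rw [norm_pow]
    exact pow_lt_one₀ (norm_nonneg z) (mem_unitDisk.1 hz) two_ne_zero
  have hne : ∀ z ∈ unitDisk, 1 - z ^ 2 ≠ 0 := fun z hz => one_sub_ne_zero_of_norm_lt (hsq z hz)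
  have hl : ∀ z : ℂ, ‖z‖ < 1 / 4 →
      1 + z * logDeriv (fun z => (1 - z ^ 2)⁻¹) z = -1 + 2 / (1 - z ^ 2) := by
    intro z hz
    have hz0 := hne z (mem_unitDisk.2 (hz.trans (by norm_num)))
    rw [logDeriv_apply, (((hasDerivAt_pow 2 z).const_sub 1).fun_inv hz0).deriv]
    field_simp
    ring
  refine hasCarMinimum_of_eq_mul (p := fun z => (1 - z ^ 2)⁻¹) (by ext; ring)
    (DifferentiableOn.inv (by fun_prop) hne) (by simp) (fun z hz => inv_ne_zero (hne z hz))
    (by simp) (fun z hz => ⟨-1 + 2 / (1 - ‖z ^ 2‖ ^ 2), ?_, ?_⟩) (fun s hs hs1 => ?_)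
  · have h4 : ‖z‖ ^ 4 ≤ (1 / 4) ^ 4 := pow_le_pow_left₀ (norm_nonneg z) hz.le 4
    rw [norm_pow, ← pow_mul, show 2 * 2 = 4 from rfl, ← le_sub_iff_add_le', div_le_iff₀ (by linarith)]
    linarith
  · have := norm_add_mul_inv_one_sub_sub (hsq z (mem_unitDisk.2 (hz.trans (by norm_num)))) (-1) 2
    push_cast at this
    rw [hl z hz]
    push_cast
    rw [this, norm_pow]
    have h0 := norm_nonneg z
    have h1 : 1 - ‖z‖ ^ 2 ≠ 0 := by nlinarith
    have h2 : 1 + ‖z‖ ^ 2 ≠ 0 := by positivity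
    rw [show 1 - (‖z‖ ^ 2) ^ 2 = (1 - ‖z‖ ^ 2) * (1 + ‖z‖ ^ 2) by ring, abs_two]
    apply le_of_eq
    field_simp
    ring
  · rw [hl _ (by simpa [abs_of_pos hs] using hs1), mul_pow, I_sq]
    have h2 : ((1 + s ^ 2 : ℝ) : ℂ) ≠ 0 := ofReal_ne_zero.2 (by positivity)
    push_cast at h2 ⊢
    rw [mul_neg_one, sub_neg_eq_add]
    field_simp
    ring

theorem hasCarMinimum_koebe :
    HasCarMinimum (fun z => z / (1 - z) ^ 2) (fun s => (1 - s) / (1 + s)) (-1) := by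
  have hne : ∀ z ∈ unitDisk, 1 - z ≠ 0 := fun z hz => one_sub_ne_zero_of_norm_lt (mem_unitDisk.1 hz)
  have hl : ∀ z : ℂ, ‖z‖ < 1 / 4 →
      1 + z * logDeriv (fun z => ((1 - z) ^ 2)⁻¹) z = -1 + 2 / (1 - z) := by
    intro z hz
    have hz0 := hne z (mem_unitDisk.2 (hz.trans (by norm_num)))
    rw [logDeriv_apply,
      ((((hasDerivAt_id' z).const_sub 1).fun_pow 2).fun_inv (pow_ne_zero 2 hz0)).deriv]
    field_simp
    ring
  refine hasCarMinimum_of_eq_mul (p := fun z => ((1 - z) ^ 2)⁻¹) (by ext; ring)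
    (DifferentiableOn.inv (by fun_prop) fun z hz => pow_ne_zero 2 (hne z hz)) (by simp)
    (fun z hz => inv_ne_zero (pow_ne_zero 2 (hne z hz)))
    (by simp) (fun z hz => ⟨-1 + 2 / (1 - ‖z‖ ^ 2), ?_, ?_⟩) (fun s hs hs1 => ?_)
  · have h2 : ‖z‖ ^ 2 ≤ (1 / 4) ^ 2 := pow_le_pow_left₀ (norm_nonneg z) hz.le 2
    rw [← le_sub_iff_add_le', div_le_iff₀ (by linarith)]
    linarith
  · have := norm_add_mul_inv_one_sub_sub (ζ := z) (hz.trans (by norm_num)) (-1) 2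
    push_cast at this
    rw [hl z hz]
    push_cast
    rw [this]
    have h0 := norm_nonneg z
    have h1 : 1 - ‖z‖ ≠ 0 := by linarith
    have h2 : 1 + ‖z‖ ≠ 0 := by linarith
    rw [show 1 - ‖z‖ ^ 2 = (1 - ‖z‖) * (1 + ‖z‖) by ring, abs_two]
    apply le_of_eq
    field_simp
    ring
  · rw [hl _ (by simpa [abs_of_pos hs] using hs1)]
    have h2 : ((1 + s : ℝ) : ℂ) ≠ 0 := ofReal_ne_zero.2 (by positivity)
    push_cast at h2 ⊢
    rw [mul_neg_one, sub_neg_eq_add]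
    field_simp
    ring

theorem hasCarMinimum_add_sq_div_two :
    HasCarMinimum (fun z => z + z ^ 2 / 2) (fun s => 2 * (1 - s) / (2 - s)) (-1) := by
  have hhalf : ∀ z : ℂ, ‖-(z / 2)‖ = ‖z‖ / 2 := fun z => by simp
  have hlt : ∀ z ∈ unitDisk, ‖-(z / 2)‖ < 1 := fun z hz => by
    rw [hhalf]
    linarith [mem_unitDisk.1 hz]
  have hne : ∀ z ∈ unitDisk, 1 + z / 2 ≠ 0 := fun z hz => by
    simpa using one_sub_ne_zero_of_norm_lt (hlt z hz)
  have hl : ∀ z : ℂ, ‖z‖ < 1 / 4 →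
      1 + z * logDeriv (fun z => 1 + z / 2) z = 2 + -1 / (1 - -(z / 2)) := by
    intro z hz
    have hz0 := hne z (mem_unitDisk.2 (hz.trans (by norm_num)))
    rw [logDeriv_apply, (((hasDerivAt_id' z).div_const 2).const_add 1).deriv, sub_neg_eq_add]
    have : z * (1 / 2 / (1 + z / 2)) = 1 - 1 / (1 + z / 2) := by
      rw [eq_sub_iff_add_eq, mul_div_assoc', ← add_div, div_eq_one_iff_eq hz0]
      ring
    rw [this]
    ring
  refine hasCarMinimum_of_eq_mul (p := fun z => 1 + z / 2) (by ext; ring)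
    (by fun_prop) (by simp) hne
    -- The coefficient `-1` reverses orientation: the leftmost point comes from the largest value of
    -- `1/(1 + z/2)`, at `z = -s`.
    (by simp) (fun z hz => ⟨2 + -1 / (1 - ‖-(z / 2)‖ ^ 2), ?_, ?_⟩) (fun s hs hs1 => ?_)
  · rw [← le_sub_iff_add_le', hhalf, div_le_iff₀ (by nlinarith [norm_nonneg z])]
    nlinarith [norm_nonneg z]
  · have := norm_add_mul_inv_one_sub_sub (hlt z (mem_unitDisk.2 (hz.trans (by norm_num)))) 2 (-1)
    push_cast at this
    rw [hl z hz]
    push_cast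
    rw [this, hhalf]
    have h0 := norm_nonneg z
    have h1 : 2 - ‖z‖ ≠ 0 := by linarith
    have h2 : 2 + ‖z‖ ≠ 0 := by linarith
    rw [show 1 - (‖z‖ / 2) ^ 2 = (2 - ‖z‖) * (2 + ‖z‖) / 4 by ring, abs_neg, abs_one]
    apply le_of_eq
    field_simp
    ring
  · rw [hl _ (by simpa [abs_of_pos hs] using hs1)]
    have h2 : ((2 - s : ℝ) : ℂ) ≠ 0 := ofReal_ne_zero.2 (by linarith)
    push_cast at h2 ⊢
    rw [show (1 : ℂ) - -((s : ℂ) * -1 / 2) = (2 - s) / 2 by ring]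
    field_simp
    ring

/-! ### Contact equations as polynomial equations -/

/-- Over a positive denominator `D` the gap `m - 1/2 - ε` has numerator `P`; monotonicity makes `P`
positive before its zero. -/
theorem isFirstContact_of_strictAntiOn {m ε P D : ℝ → ℝ} {R : ℝ}
    (hP : StrictAntiOn P (Icc 0 (1 / 4))) (hR0 : 0 < R) (hR : R < 1 / 4) (hPR : P R = 0)
    (hD : ∀ s, 0 < s → s < 1 / 4 → 0 < D s ∧ m s - 1 / 2 - ε s = P s / D s) :
    IsFirstContact m ε R := by
  refine ⟨hR0, hR, fun s hs hsR => ?_, ?_⟩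
  · obtain ⟨h1, h2⟩ := hD s hs (hsR.trans hR)
    have := div_pos (hPR ▸ hP ⟨hs.le, (hsR.trans hR).le⟩ ⟨hR0.le, hR.le⟩ hsR) h1
    linarith
  · have h2 := (hD R hR0 hR).2
    rw [hPR, zero_div] at h2
    linarith

/-- The hypothesis makes the divided difference negative, each of its monomials being bounded by its
value at `s = t = 1/4`. -/
theorem strictAntiOn_quartic {a b c d e : ℝ} (hd : |a| / 16 + |b| * 3 / 16 + |c| / 2 < d) :
    StrictAntiOn (fun r : ℝ => a * r ^ 4 + b * r ^ 3 + c * r ^ 2 - d * r + e) (Icc 0 (1 / 4)) := by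
  rintro s ⟨hs0, hs1⟩ t ⟨ht0, ht1⟩ hst
  have hdiff : (a * t ^ 4 + b * t ^ 3 + c * t ^ 2 - d * t + e) -
      (a * s ^ 4 + b * s ^ 3 + c * s ^ 2 - d * s + e) =
      (t - s) * (a * ((t + s) * (t ^ 2 + s ^ 2)) + b * (t ^ 2 + t * s + s ^ 2) + c * (t + s) - d) := by
    ring
  have ht2 : t ^ 2 ≤ 1 / 16 := by nlinarith
  have hs2 : s ^ 2 ≤ 1 / 16 := by nlinarith
  have h1 : a * ((t + s) * (t ^ 2 + s ^ 2)) ≤ |a| * (1 / 2 * (1 / 8)) :=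
    mul_le_mul (le_abs_self a) (mul_le_mul (by linarith) (by linarith) (by positivity) (by norm_num))
      (by positivity) (abs_nonneg a)
  have h2 : b * (t ^ 2 + t * s + s ^ 2) ≤ |b| * (3 / 16) :=
    mul_le_mul (le_abs_self b) (by nlinarith) (by positivity) (abs_nonneg b)
  have h3 : c * (t + s) ≤ |c| * (1 / 2) :=
    mul_le_mul (le_abs_self c) (by linarith) (by positivity) (abs_nonneg c)
  have := mul_neg_of_pos_of_neg (sub_pos.2 hst) (b := a * ((t + s) * (t ^ 2 + s ^ 2)) +
    b * (t ^ 2 + t * s + s ^ 2) + c * (t + s) - d) (by linarith)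
  simp only
  linarith

theorem strictAntiOn_of_eq_quartic {P : ℝ → ℝ} (a b c d e : ℝ)
    (hP : ∀ r, P r = a * r ^ 4 + b * r ^ 3 + c * r ^ 2 - d * r + e)
    (hd : |a| / 16 + |b| * 3 / 16 + |c| / 2 < d) : StrictAntiOn P (Icc 0 (1 / 4)) := by
  rw [show P = _ from funext hP]
  exact strictAntiOn_quartic hd

/-- The sign change locates a root, and strict monotonicity on `[0, 1/4]` excludes any smaller
positive one. -/
theorem exists_isLeastRoot {P : ℝ → ℝ} (hP : StrictAntiOn P (Icc 0 (1 / 4)))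
    (hc : Continuous P) {l u : ℝ} (hl : 0 ≤ l) (hlu : l ≤ u) (hu : u ≤ 1 / 4) (hPl : 0 < P l)
    (hPu : P u < 0) : ∃ R, IsLeastRoot P R ∧ l < R ∧ R < u ∧ P R = 0 := by
  obtain ⟨R, hR, hPR⟩ := intermediate_value_Ioo' hlu hc.continuousOn ⟨hPu, hPl⟩
  have hR4 : R < 1 / 4 := hR.2.trans_le hu
  have hR0 : 0 < R := hl.trans_lt hR.1
  refine ⟨R, ⟨⟨hR0, hR4.trans (by norm_num), hPR⟩, ?_⟩, hR.1, hR.2, hPR⟩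
  rintro x ⟨hx0, -, hx⟩
  by_contra! hlt
  have := hP ⟨hx0.le, (hlt.trans hR4).le⟩ ⟨hR0.le, hR4.le⟩ hlt
  rw [hx, hPR] at this
  exact this.false

/-! ### The entries of the table -/

theorem hasCarRadii_id : HasCarRadii (fun z => z)
    (1 / (4 + Real.sqrt 17)) (1 / (3 + 2 * Real.sqrt 3)) (1 / (2 + Real.sqrt 5)) := by
  have hD : ∀ s : ℝ, 0 < s → s < 1 / 4 → 0 < 2 * (1 - s ^ 2) := fun s hs hs1 => by nlinarith
  have q17 := Real.sq_sqrt (show (0 : ℝ) ≤ 17 by norm_num)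
  have q3 := Real.sq_sqrt (show (0 : ℝ) ≤ 3 by norm_num)
  have q5 := Real.sq_sqrt (show (0 : ℝ) ≤ 5 by norm_num)
  have p5 : 2 < Real.sqrt 5 := Real.lt_sqrt_of_sq_lt (by norm_num)
  have p3' : 1 < Real.sqrt 3 := Real.lt_sqrt_of_sq_lt (by norm_num)
  have p17' : 4 < Real.sqrt 17 := Real.lt_sqrt_of_sq_lt (by norm_num)
  refine hasCarMinimum_id.hasCarRadii ?_ ?_ ?_
  · refine isFirstContact_of_strictAntiOn (P := fun s => 1 - 8 * s - s ^ 2)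
      (strictAntiOn_of_eq_quartic 0 0 (-1) 8 1 (fun r => by ring) (by norm_num)) (by positivity)
      (one_div_lt_one_div_of_lt (by norm_num) (by linarith)) ?_
      (fun s hs hs1 => ⟨hD s hs hs1, ?_⟩)
    · field_simp
      linear_combination q17
    · have : 1 - s ^ 2 ≠ 0 := by nlinarith
      field_simp
      ring
  · refine isFirstContact_of_strictAntiOn (P := fun s => 1 - 6 * s - 3 * s ^ 2)
      (strictAntiOn_of_eq_quartic 0 0 (-3) 6 1 (fun r => by ring) (by norm_num)) (by positivity)
      (one_div_lt_one_div_of_lt (by norm_num) (by linarith)) ?_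
      (fun s hs hs1 => ⟨hD s hs hs1, ?_⟩)
    · field_simp
      linear_combination 4 * q3
    · have : 1 - s ^ 2 ≠ 0 := by nlinarith
      field_simp
      ring
  · refine isFirstContact_of_strictAntiOn (P := fun s => 1 - 4 * s - s ^ 2)
      (strictAntiOn_of_eq_quartic 0 0 (-1) 4 1 (fun r => by ring) (by norm_num)) (by positivity)
      (one_div_lt_one_div_of_lt (by norm_num) (by linarith)) ?_
      (fun s hs hs1 => ⟨hD s hs hs1, ?_⟩)
    · field_simp
      linear_combination q5
    · have : 1 - s ^ 2 ≠ 0 := by nlinarith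
      field_simp
      ring

theorem hasCarRadii_div_one_add : HasCarRadii (fun z => z / (1 + z))
    (5 - 2 * Real.sqrt 6) (Real.sqrt 17 - 4) (3 - 2 * Real.sqrt 2) := by
  have hD : ∀ s : ℝ, 0 < s → s < 1 / 4 → 0 < 2 * ((1 - s) * (1 + s)) := fun s hs hs1 => by nlinarith
  have hne : ∀ s : ℝ, 0 < s → s < 1 / 4 → 1 - s ≠ 0 ∧ 1 + s ≠ 0 := fun s hs hs1 =>
    ⟨by linarith, by linarith⟩
  have hs2 : ∀ s : ℝ, 1 - s ^ 2 = (1 - s) * (1 + s) := fun s => by ring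
  have q6 := Real.sq_sqrt (show (0 : ℝ) ≤ 6 by norm_num)
  have q17 := Real.sq_sqrt (show (0 : ℝ) ≤ 17 by norm_num)
  have q2 := Real.sq_sqrt (show (0 : ℝ) ≤ 2 by norm_num)
  have l6 : 2.4 < Real.sqrt 6 := Real.lt_sqrt_of_sq_lt (by norm_num)
  have u6 : Real.sqrt 6 < 2.5 := (Real.sqrt_lt' (by norm_num)).2 (by norm_num)
  have l17 : 4 < Real.sqrt 17 := Real.lt_sqrt_of_sq_lt (by norm_num)
  have u17 : Real.sqrt 17 < 4.2 := (Real.sqrt_lt' (by norm_num)).2 (by norm_num)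
  have l2 : 1.4 < Real.sqrt 2 := Real.lt_sqrt_of_sq_lt (by norm_num)
  have u2 : Real.sqrt 2 < 1.5 := (Real.sqrt_lt' (by norm_num)).2 (by norm_num)
  refine hasCarMinimum_div_one_add.hasCarRadii ?_ ?_ ?_
  · refine isFirstContact_of_strictAntiOn (P := fun s => 1 - 10 * s + s ^ 2)
      (strictAntiOn_of_eq_quartic 0 0 1 10 1 (fun r => by ring) (by norm_num)) (by linarith)
      (by linarith) (by linear_combination 4 * q6) (fun s hs hs1 => ⟨hD s hs hs1, ?_⟩)
    obtain ⟨h1, h2⟩ := hne s hs hs1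
    rw [hs2]
    field_simp
    ring
  · refine isFirstContact_of_strictAntiOn (P := fun s => 1 - 8 * s - s ^ 2)
      (strictAntiOn_of_eq_quartic 0 0 (-1) 8 1 (fun r => by ring) (by norm_num)) (by linarith)
      (by linarith) (by linear_combination -q17) (fun s hs hs1 => ⟨hD s hs hs1, ?_⟩)
    obtain ⟨h1, h2⟩ := hne s hs hs1
    rw [hs2]
    field_simp
    ring
  · refine isFirstContact_of_strictAntiOn (P := fun s => 1 - 6 * s + s ^ 2)
      (strictAntiOn_of_eq_quartic 0 0 1 6 1 (fun r => by ring) (by norm_num)) (by linarith)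
      (by linarith) (by linear_combination 4 * q2) (fun s hs hs1 => ⟨hD s hs hs1, ?_⟩)
    obtain ⟨h1, h2⟩ := hne s hs hs1
    rw [hs2]
    field_simp
    ring

theorem hasCarRadii_koebe : HasCarRadii (fun z => z / (1 - z) ^ 2)
    ((6 - Real.sqrt 33) / 3) (5 - 2 * Real.sqrt 6) ((4 - Real.sqrt 13) / 3) := by
  have hD : ∀ s : ℝ, 0 < s → s < 1 / 4 → 0 < 2 * ((1 - s) * (1 + s)) := fun s hs hs1 => by nlinarith
  have hne : ∀ s : ℝ, 0 < s → s < 1 / 4 → 1 - s ≠ 0 ∧ 1 + s ≠ 0 := fun s hs hs1 =>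
    ⟨by linarith, by linarith⟩
  have hs2 : ∀ s : ℝ, 1 - s ^ 2 = (1 - s) * (1 + s) := fun s => by ring
  have q33 := Real.sq_sqrt (show (0 : ℝ) ≤ 33 by norm_num)
  have q6 := Real.sq_sqrt (show (0 : ℝ) ≤ 6 by norm_num)
  have q13 := Real.sq_sqrt (show (0 : ℝ) ≤ 13 by norm_num)
  have l33 : 5.7 < Real.sqrt 33 := Real.lt_sqrt_of_sq_lt (by norm_num)
  have u33 : Real.sqrt 33 < 6 := (Real.sqrt_lt' (by norm_num)).2 (by norm_num)
  have l6 : 2.4 < Real.sqrt 6 := Real.lt_sqrt_of_sq_lt (by norm_num)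
  have u6 : Real.sqrt 6 < 2.5 := (Real.sqrt_lt' (by norm_num)).2 (by norm_num)
  have l13 : 3.5 < Real.sqrt 13 := Real.lt_sqrt_of_sq_lt (by norm_num)
  have u13 : Real.sqrt 13 < 4 := (Real.sqrt_lt' (by norm_num)).2 (by norm_num)
  refine hasCarMinimum_koebe.hasCarRadii ?_ ?_ ?_
  · refine isFirstContact_of_strictAntiOn (P := fun s => 1 - 12 * s + 3 * s ^ 2)
      (strictAntiOn_of_eq_quartic 0 0 3 12 1 (fun r => by ring) (by norm_num)) (by linarith)
      (by linarith) (by linear_combination q33 / 3) (fun s hs hs1 => ⟨hD s hs hs1, ?_⟩)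
    obtain ⟨h1, h2⟩ := hne s hs hs1
    rw [hs2]
    field_simp
    ring
  · refine isFirstContact_of_strictAntiOn (P := fun s => 1 - 10 * s + s ^ 2)
      (strictAntiOn_of_eq_quartic 0 0 1 10 1 (fun r => by ring) (by norm_num)) (by linarith)
      (by linarith) (by linear_combination 4 * q6) (fun s hs hs1 => ⟨hD s hs hs1, ?_⟩)
    obtain ⟨h1, h2⟩ := hne s hs hs1
    rw [hs2]
    field_simp
    ring
  · refine isFirstContact_of_strictAntiOn (P := fun s => 1 - 8 * s + 3 * s ^ 2)
      (strictAntiOn_of_eq_quartic 0 0 3 8 1 (fun r => by ring) (by norm_num)) (by linarith)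
      (by linarith) (by linear_combination q13 / 3) (fun s hs hs1 => ⟨hD s hs hs1, ?_⟩)
    obtain ⟨h1, h2⟩ := hne s hs hs1
    rw [hs2]
    field_simp
    ring

theorem exists_hasCarRadii_div_one_sub_sq : ∃ r₁ r₂ r₃ : ℝ,
    IsLeastRoot (fun r => 3 * r ^ 4 - 8 * r ^ 3 - 4 * r ^ 2 - 8 * r + 1) r₁ ∧
    IsLeastRoot (fun r => r ^ 4 - 6 * r ^ 3 - 6 * r ^ 2 - 6 * r + 1) r₂ ∧
    IsLeastRoot (fun r => 3 * r ^ 4 - 4 * r ^ 3 - 4 * r ^ 2 - 4 * r + 1) r₃ ∧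
    |r₁ - 0.11667| < 0.00001 ∧ |r₂ - 0.14326| < 0.00001 ∧ |r₃ - 0.20213| < 0.00001 ∧
    HasCarRadii (fun z => z / (1 - z ^ 2)) r₁ r₂ r₃ := by
  have hD : ∀ s : ℝ, 0 < s → s < 1 / 4 → 0 < 2 * ((1 + s ^ 2) * (1 - s ^ 2)) := fun s hs hs1 => by
    have : 0 < 1 - s ^ 2 := by nlinarith
    positivity
  have hne : ∀ s : ℝ, 0 < s → s < 1 / 4 → 1 + s ^ 2 ≠ 0 ∧ 1 - s ^ 2 ≠ 0 := fun s hs hs1 =>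
    ⟨by positivity, by nlinarith⟩
  have a₁ := strictAntiOn_of_eq_quartic (P := fun r => 3 * r ^ 4 - 8 * r ^ 3 - 4 * r ^ 2 - 8 * r + 1)
    3 (-8) (-4) 8 1 (fun r => by ring) (by norm_num)
  have a₂ := strictAntiOn_of_eq_quartic (P := fun r => r ^ 4 - 6 * r ^ 3 - 6 * r ^ 2 - 6 * r + 1)
    1 (-6) (-6) 6 1 (fun r => by ring) (by norm_num)
  have a₃ := strictAntiOn_of_eq_quartic (P := fun r => 3 * r ^ 4 - 4 * r ^ 3 - 4 * r ^ 2 - 4 * r + 1)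
    3 (-4) (-4) 4 1 (fun r => by ring) (by norm_num)
  -- Each bracket is the stated decimal plus or minus `10⁻⁵`, so the sign change also proves the
  -- error bound.
  obtain ⟨r₁, hr₁, hl₁, hu₁, hP₁⟩ := exists_isLeastRoot a₁ (by fun_prop)
    (l := 0.11666) (u := 0.11668) (by norm_num) (by norm_num) (by norm_num) (by norm_num)
    (by norm_num)
  obtain ⟨r₂, hr₂, hl₂, hu₂, hP₂⟩ := exists_isLeastRoot a₂ (by fun_prop)
    (l := 0.14325) (u := 0.14327) (by norm_num) (by norm_num) (by norm_num) (by norm_num)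
    (by norm_num)
  obtain ⟨r₃, hr₃, hl₃, hu₃, hP₃⟩ := exists_isLeastRoot a₃ (by fun_prop)
    (l := 0.20212) (u := 0.20214) (by norm_num) (by norm_num) (by norm_num) (by norm_num)
    (by norm_num)
  refine ⟨r₁, r₂, r₃, hr₁, hr₂, hr₃, abs_lt.2 ⟨by linarith, by linarith⟩,
    abs_lt.2 ⟨by linarith, by linarith⟩, abs_lt.2 ⟨by linarith, by linarith⟩,
    hasCarMinimum_div_one_sub_sq.hasCarRadii
      (isFirstContact_of_strictAntiOn a₁ hr₁.1.1 (by linarith) hP₁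
        fun s hs hs1 => ⟨hD s hs hs1, ?_⟩)
      (isFirstContact_of_strictAntiOn a₂ hr₂.1.1 (by linarith) hP₂
        fun s hs hs1 => ⟨hD s hs hs1, ?_⟩)
      (isFirstContact_of_strictAntiOn a₃ hr₃.1.1 (by linarith) hP₃
        fun s hs hs1 => ⟨hD s hs hs1, ?_⟩)⟩
  all_goals
    obtain ⟨h1, h2⟩ := hne s hs hs1
    field_simp
    ring

theorem exists_hasCarRadii_add_sq_div_two : ∃ s₁ s₂ s₃ : ℝ,
    IsLeastRoot (fun r => 3 * r ^ 3 + 6 * r ^ 2 - 19 * r + 2) s₁ ∧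
    IsLeastRoot (fun r => 5 * r ^ 3 - 15 * r + 2) s₂ ∧
    IsLeastRoot (fun r => 3 * r ^ 3 + 2 * r ^ 2 - 11 * r + 2) s₃ ∧
    |s₁ - 0.10924| < 0.00001 ∧ |s₂ - 0.13414| < 0.00001 ∧ |s₃ - 0.19028| < 0.00001 ∧
    HasCarRadii (fun z => z + z ^ 2 / 2) s₁ s₂ s₃ := by
  have hD : ∀ s : ℝ, 0 < s → s < 1 / 4 → 0 < 2 * ((2 - s) * (1 - s ^ 2)) := fun s hs hs1 => by
    have : 0 < 1 - s ^ 2 := by nlinarith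
    have : 0 < 2 - s := by linarith
    positivity
  have hne : ∀ s : ℝ, 0 < s → s < 1 / 4 → 2 - s ≠ 0 ∧ 1 - s ^ 2 ≠ 0 := fun s hs hs1 =>
    ⟨by linarith, by nlinarith⟩
  have a₁ := strictAntiOn_of_eq_quartic (P := fun r => 3 * r ^ 3 + 6 * r ^ 2 - 19 * r + 2)
    0 3 6 19 2 (fun r => by ring) (by norm_num)
  have a₂ := strictAntiOn_of_eq_quartic (P := fun r => 5 * r ^ 3 - 15 * r + 2)
    0 5 0 15 2 (fun r => by ring) (by norm_num)
  have a₃ := strictAntiOn_of_eq_quartic (P := fun r => 3 * r ^ 3 + 2 * r ^ 2 - 11 * r + 2)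
    0 3 2 11 2 (fun r => by ring) (by norm_num)
  obtain ⟨r₁, hr₁, hl₁, hu₁, hP₁⟩ := exists_isLeastRoot a₁ (by fun_prop)
    (l := 0.10923) (u := 0.10925) (by norm_num) (by norm_num) (by norm_num) (by norm_num)
    (by norm_num)
  obtain ⟨r₂, hr₂, hl₂, hu₂, hP₂⟩ := exists_isLeastRoot a₂ (by fun_prop)
    (l := 0.13413) (u := 0.13415) (by norm_num) (by norm_num) (by norm_num) (by norm_num)
    (by norm_num)
  obtain ⟨r₃, hr₃, hl₃, hu₃, hP₃⟩ := exists_isLeastRoot a₃ (by fun_prop)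
    (l := 0.19027) (u := 0.19029) (by norm_num) (by norm_num) (by norm_num) (by norm_num)
    (by norm_num)
  refine ⟨r₁, r₂, r₃, hr₁, hr₂, hr₃, abs_lt.2 ⟨by linarith, by linarith⟩,
    abs_lt.2 ⟨by linarith, by linarith⟩, abs_lt.2 ⟨by linarith, by linarith⟩,
    hasCarMinimum_add_sq_div_two.hasCarRadii
      (isFirstContact_of_strictAntiOn a₁ hr₁.1.1 (by linarith) hP₁
        fun s hs hs1 => ⟨hD s hs hs1, ?_⟩)
      (isFirstContact_of_strictAntiOn a₂ hr₂.1.1 (by linarith) hP₂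
        fun s hs hs1 => ⟨hD s hs hs1, ?_⟩)
      (isFirstContact_of_strictAntiOn a₃ hr₃.1.1 (by linarith) hP₃
        fun s hs hs1 => ⟨hD s hs hs1, ?_⟩)⟩
  all_goals
    obtain ⟨h1, h2⟩ := hne s hs hs1
    field_simp
    ring

end CardioidRadius

open CardioidRadius in
theorem theorem6p1 :
    HasCarRadii (fun z => z)
      (1 / (4 + Real.sqrt 17)) (1 / (3 + 2 * Real.sqrt 3)) (1 / (2 + Real.sqrt 5)) ∧
    HasCarRadii (fun z => z / (1 + z))
      (5 - 2 * Real.sqrt 6) (Real.sqrt 17 - 4) (3 - 2 * Real.sqrt 2) ∧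
    (∃ r₁ r₂ r₃ : ℝ,
      IsLeastRoot (fun r => 3 * r ^ 4 - 8 * r ^ 3 - 4 * r ^ 2 - 8 * r + 1) r₁ ∧
      IsLeastRoot (fun r => r ^ 4 - 6 * r ^ 3 - 6 * r ^ 2 - 6 * r + 1) r₂ ∧
      IsLeastRoot (fun r => 3 * r ^ 4 - 4 * r ^ 3 - 4 * r ^ 2 - 4 * r + 1) r₃ ∧
      |r₁ - 0.11667| < 0.00001 ∧ |r₂ - 0.14326| < 0.00001 ∧ |r₃ - 0.20213| < 0.00001 ∧
      HasCarRadii (fun z => z / (1 - z ^ 2)) r₁ r₂ r₃) ∧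
    HasCarRadii (fun z => z / (1 - z) ^ 2)
      ((6 - Real.sqrt 33) / 3) (5 - 2 * Real.sqrt 6) ((4 - Real.sqrt 13) / 3) ∧
    (∃ s₁ s₂ s₃ : ℝ,
      IsLeastRoot (fun r => 3 * r ^ 3 + 6 * r ^ 2 - 19 * r + 2) s₁ ∧
      IsLeastRoot (fun r => 5 * r ^ 3 - 15 * r + 2) s₂ ∧
      IsLeastRoot (fun r => 3 * r ^ 3 + 2 * r ^ 2 - 11 * r + 2) s₃ ∧
      |s₁ - 0.10924| < 0.00001 ∧ |s₂ - 0.13414| < 0.00001 ∧ |s₃ - 0.19028| < 0.00001 ∧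
      HasCarRadii (fun z => z + z ^ 2 / 2) s₁ s₂ s₃) :=
  ⟨hasCarRadii_id, hasCarRadii_div_one_add, exists_hasCarRadii_div_one_sub_sq, hasCarRadii_koebe,
    exists_hasCarRadii_add_sq_div_two⟩
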